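/- Let $k=\mathbb{Q}(\beta)$ and let $x=(x_1,x_2,\dots)$ be variables with power sums $p_n=p_n(x)=\sum_i x_i^n$. **Neutral fermions.** Let $\phi_n$ $(n\in\mathbb{Z})$ be the neutral fermions, $\phi_m\phi_n+\phi_n\phi_m=2(-1)^m\delta_{m+n,0}$, acting on the Fock space $\mathcal F$ with basis $\phi_{n_1}\cdots\phi_{n_s}|0\rangle$ $(n_1>\dots>n_s\ge 0)$, where $\phi_{-n}|0\rangle=0$ and $\langle 0|\phi_n=0$ for $n>0$, $\langle 0|0\rangle=1$ and $\langle 0|\phi_0|0\rangle=0$ (scalars extended so as to contain the $p_n$). For odd $m$ let $b_m=\frac14\sum_{i\in\mathbb{Z}}(-1)^i\phi_{-i-m}\phi_i$. Let $*$ be the linear anti-involution with $\phi_n^*=(-1)^n\phi_{-n}$, so that $b_m^*=b_{-m}$. **Deformed operators.** Let $\phi^{(\beta)}_n$ be defined by $\sum_{n\ge0}\phi^{(\beta)}_nz^n=\sum_{n\ge0}\phi_n(z+\frac\beta2)^n$ and $\sum_{n>0}\phi^{(\beta)}_{-n}z^{-n}=\sum_{n>0}\phi_{-n}\bigl(\frac{z^{-1}}{1+\frac\beta2z^{-1}}\bigr)^n$,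 and put $\phi^{[\beta]}_n=(-1)^n(\phi^{(-\beta)}_{-n})^*$. For $n\ge1$ let $b^{(\beta)}_{-n}$ be obtained from $\frac12\bigl((X-\frac\beta2)^{-n}-(-X-\frac\beta2)^{-n}\bigr)$, expanded in powers of $X^{-1}$, by the substitution $X^{-l}\mapsto b_{-l}$, and put $$b^{[\beta]}_n=(b^{(\beta)}_{-n})^*,\qquad \mathcal H^{[\beta]}=2\sum_{n\ge1}\frac{p_n}{n}b^{[\beta]}_n,\qquad \theta=2\sum_{n=1,3,5,\dots}\Bigl(\frac\beta2\Bigr)^n\frac{b_n}{n}.$$ For a finite sequence $\lambda=(\lambda_1,\dots,\lambda_r)$ of non-negative integers put $|\lambda_1,\dots,\lambda_r\rangle^g=e^{-\theta}\phi^{[\beta]}_{\lambda_1}e^{-\theta}\phi^{[\beta]}_{\lambda_2}\cdots e^{-\theta}\phi^{[\beta]}_{\lambda_r}|0\rangle$ and $$o_\lambda(x)=\begin{cases}2^{-r}\langle0|e^{\mathcal H^{[\beta]}}|\lambda_1,\dots,\lambda_r\rangle^g,& r\text{ even},\\ 2^{-r}\langle0|e^{\mathcal H^{[\beta]}}|\lambda_1,\dots,\lambda_r,0\rangle^g,&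 r\text{ odd}.\end{cases}$$ **The functions $q^{[\beta]}_n$ and the coefficients.** Let $\bar z=\frac{-z}{1+\beta z}$, define $q^{[\beta]}_n(x)$ $(n\ge0)$ by $\sum_{n\ge0}q^{[\beta]}_n(x)z^n=\prod_i\frac{1-x_i\bar z}{1-x_iz}$, and put $q^{[\beta]}_n=0$ for $n<0$. Let $g^{i,j}_{p,q}$ be the coefficient of $z^pw^q$ in the expansion of $$(1+\beta z)^{-i}(1+\beta w)^{-j}\frac{z-w}{z+w+\beta zw}$$ in $k((z))((w))$ (that is, on $|w|<|z|$), and let $g^{i,r+1}_p$ be the coefficient of $z^p$ in $(1+\beta z)^{-i}$. **Proposition.** The coefficients $g^{i,j}_{p,q}$ and $g^{i,r+1}_p$ lie in $\mathbb{Q}[\beta]$, and $g^{i,j}_{p,q}=0$ unless $p+q\ge0$ and $q\ge0$. Let $\lambda=(\lambda_1>\dots>\lambda_r>0)$ be a strict partition of length $r\ge0$, and let $r'$ be the smallest even integer with $r'\ge r$. Then $$o_\lambda(x)=2^{-r}\,\mathrm{Pf}(\zeta_{i,j})_{1\le i<j\le r'},\qquad \zeta_{i,j}=\begin{cases}\displaystyle\sum_{p+q\ge0,\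 q\ge0}g^{i,j}_{p,q}\,q^{[\beta]}_{\lambda_i-p}(x)\,q^{[\beta]}_{\lambda_j-q}(x),& j\ne r+1,\\ \displaystyle\sum_{p\ge0}g^{i,r+1}_p\,q^{[\beta]}_{\lambda_i-p}(x),& j=r+1,\end{cases}$$ where $\mathrm{Pf}(a_{i,j})_{1\le i<j\le 2m}=\sum_\sigma\mathrm{sgn}(\sigma)\,a_{\sigma(1),\sigma(2)}\cdots a_{\sigma(2m-1),\sigma(2m)}$ over all $\sigma\in S_{2m}$ with $\sigma(1)<\sigma(3)<\dots<\sigma(2m-1)$ and $\sigma(2t-1)<\sigma(2t)$ for all $t$. Moreover, for every $n\ge0$, the function $o_n=o_{(n)}$ of the one-term sequence $(n)$ is $$o_n(x)=\frac12\sum_{k=0}^n(-\beta)^kq^{[\beta]}_{n-k}(x).$$ -/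

import Mathlib

noncomputable section

namespace DualKQ

/-! ### Pfaffians -/

section Pfaffian

variable {R : Type*} [CommRing R]

/-- The Pfaffian of an array `(a i j)_{i < j}` indexed by `Fin (2 * m)`: the signed sum over the
permutations `σ` with `σ 0 < σ 2 < σ 4 < ⋯` and `σ (2 t) < σ (2 t + 1)` for all `t`
(positions are counted from `0`). -/
def pfaffian (m : ℕ) (a : Fin (2 * m) → Fin (2 * m) → R) : R :=
  open Classical in
  ∑ σ : Equiv.Perm (Fin (2 * m)),
    if (∀ s t : Fin m, s < t → σ ⟨2 * s.val, by omega⟩ < σ ⟨2 * t.val, by omega⟩) ∧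
        (∀ t : Fin m, σ ⟨2 * t.val, by omega⟩ < σ ⟨2 * t.val + 1, by omega⟩) then
      ((Equiv.Perm.sign σ : ℤ) : R) *
        ∏ t : Fin m, a (σ ⟨2 * t.val, by omega⟩) (σ ⟨2 * t.val + 1, by omega⟩)
    else 0

end Pfaffian

/-! ### Neutral fermions and their Fock space, over a commutative ring `R` of scalars -/

section Fermions

variable (R : Type*) [CommRing R]

/-- The Fock space of neutral fermions. The product
`e_{n_1} ∧ ⋯ ∧ e_{n_r}` with `n_1 > ⋯ > n_r ≥ 0` is the vector `φ_{n_1} ⋯ φ_{n_r} |0⟩`. -/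
abbrev Fock : Type _ := ExteriorAlgebra R (ℕ →₀ R)

/-- The vacuum vector `|0⟩`. -/
abbrev vac : Fock R := 1

variable {R}

/-- The vacuum expectation value `v ↦ ⟨0|v⟩`. -/
def vev (v : Fock R) : R := ExteriorAlgebra.algebraMapInv v

/-- Exterior multiplication by the `n`-th basis vector, from the left. -/
def wedge (n : ℕ) : Fock R →ₗ[R] Fock R :=
  LinearMap.mulLeft R (ExteriorAlgebra.ι R (Finsupp.single n (1 : R)))

/-- Contraction with the `n`-th coordinate form, from the left. -/
def contr (n : ℕ) : Fock R →ₗ[R] Fock R :=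
  CliffordAlgebra.contractLeft (Finsupp.lapply n : (ℕ →₀ R) →ₗ[R] R)

/-- The neutral fermion `φ_n`, `n ∈ ℤ`, acting on the Fock space. -/
def phi (n : ℤ) : Fock R →ₗ[R] Fock R :=
  if 0 < n then wedge n.toNat
  else if n = 0 then wedge 0 + contr 0
  else (2 * (-1 : R) ^ n.natAbs) • contr n.natAbs

theorem wedge_wedge (m n : ℕ) (v : Fock R) : wedge m (wedge n v) = -wedge n (wedge m v) := by
  have h := ExteriorAlgebra.ι_add_mul_swap (R := R) (Finsupp.single m (1 : R))
    (Finsupp.single n (1 : R))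
  simp only [wedge, LinearMap.mulLeft_apply, ← mul_assoc]
  rw [eq_neg_of_add_eq_zero_left h, neg_mul]

theorem contr_contr (m n : ℕ) (v : Fock R) : contr m (contr n v) = -contr n (contr m v) :=
  CliffordAlgebra.contractLeft_comm _ _ _

theorem contr_wedge (m n : ℕ) (v : Fock R) :
    contr m (wedge n v) = (if m = n then v else 0) - wedge n (contr m v) := by
  have h := CliffordAlgebra.contractLeft_ι_mul (Q := (0 : QuadraticForm R (ℕ →₀ R)))
    (d := Finsupp.lapply m) (Finsupp.single n (1 : R)) v
  simp only [contr, wedge, LinearMap.mulLeft_apply]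
  refine h.trans ?_
  congr 1
  by_cases hmn : m = n
  · simp [hmn]
  · simp [hmn]

/-- The defining relation `[φ_m, φ_n]_+ = 2 (-1)^m δ_{m+n,0}`. -/
theorem phi_anticomm (m n : ℤ) (v : Fock R) :
    phi m (phi n v) + phi n (phi m v) =
      if m + n = 0 then (2 * (-1 : R) ^ m.natAbs) • v else 0 := by
  have cw : ∀ a b : ℕ, contr a (wedge b v) + wedge b (contr a v) = if a = b then v else 0 := by
    intro a b; rw [contr_wedge]; abel
  have ww : ∀ a b : ℕ, wedge a (wedge b v) + wedge b (wedge a v) = 0 := by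
    intro a b; rw [wedge_wedge]; abel
  have cc : ∀ a b : ℕ, contr a (contr b v) + contr b (contr a v) = 0 := by
    intro a b; rw [contr_contr]; abel
  have w0 : wedge 0 (wedge 0 v) = 0 := by
    simp [wedge, ← mul_assoc]
  have c0 : contr 0 (contr 0 v) = 0 := CliffordAlgebra.contractLeft_contractLeft _ _
  have pp : ∀ k : ℤ, 0 < k → (phi k : Fock R →ₗ[R] Fock R) = wedge k.natAbs := by
    intro k hk
    rw [phi, if_pos hk, show k.toNat = k.natAbs by omega]
  have pz : (phi 0 : Fock R →ₗ[R] Fock R) = wedge 0 + contr 0 := by simp [phi]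
  have pn : ∀ k : ℤ, k < 0 →
      (phi k : Fock R →ₗ[R] Fock R) = (2 * (-1 : R) ^ k.natAbs) • contr k.natAbs := by
    intro k hk
    rw [phi, if_neg (by omega), if_neg (by omega)]
  rcases lt_trichotomy m 0 with hm | rfl | hm <;> rcases lt_trichotomy n 0 with hn | rfl | hn
  · rw [if_neg (by omega), pn m hm, pn n hn]
    simp only [LinearMap.smul_apply, map_smul]
    linear_combination (norm := module) ((2 * (-1 : R) ^ m.natAbs) * (2 * (-1 : R) ^ n.natAbs)) •
      cc m.natAbs n.natAbs
  · rw [if_neg (by omega), pn m hm, pz]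
    have e := cw m.natAbs 0
    rw [if_neg (by omega)] at e
    simp only [LinearMap.smul_apply, LinearMap.add_apply, map_smul, map_add]
    linear_combination (norm := module) (2 * (-1 : R) ^ m.natAbs) • (e + cc m.natAbs 0)
  · rw [pn m hm, pp n hn]
    have e := cw m.natAbs n.natAbs
    simp only [LinearMap.smul_apply, map_smul]
    by_cases h : m + n = 0
    · rw [if_pos (by omega)] at e
      rw [if_pos h]
      linear_combination (norm := module) (2 * (-1 : R) ^ m.natAbs) • e
    · rw [if_neg (by omega)] at e
      rw [if_neg h]
      linear_combination (norm := module) (2 * (-1 : R) ^ m.natAbs) • e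
  · rw [if_neg (by omega), pn n hn, pz]
    have e := cw n.natAbs 0
    rw [if_neg (by omega)] at e
    simp only [LinearMap.smul_apply, LinearMap.add_apply, map_smul, map_add]
    linear_combination (norm := module) (2 * (-1 : R) ^ n.natAbs) • (e + cc n.natAbs 0)
  · rw [if_pos (by omega), pz]
    have e := cw 0 0
    rw [if_pos rfl] at e
    simp only [LinearMap.add_apply, map_add, w0, c0, Int.natAbs_zero, pow_zero, mul_one]
    linear_combination (norm := module) (2 : R) • e
  · rw [if_neg (by omega), pp n hn, pz]
    have e := cw 0 n.natAbs
    rw [if_neg (by omega)] at e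
    simp only [LinearMap.add_apply, map_add]
    linear_combination (norm := module) e + ww 0 n.natAbs
  · rw [pn n hn, pp m hm]
    have e := cw n.natAbs m.natAbs
    simp only [LinearMap.smul_apply, map_smul]
    by_cases h : m + n = 0
    · rw [if_pos (by omega)] at e
      rw [if_pos h, show m.natAbs = n.natAbs by omega] at *
      linear_combination (norm := module) (2 * (-1 : R) ^ n.natAbs) • e
    · rw [if_neg (by omega)] at e
      rw [if_neg h]
      linear_combination (norm := module) (2 * (-1 : R) ^ n.natAbs) • e
  · rw [if_neg (by omega), pp m hm, pz]
    have e := cw 0 m.natAbs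
    rw [if_neg (by omega)] at e
    simp only [LinearMap.add_apply, map_add]
    linear_combination (norm := module) e + ww 0 m.natAbs
  · rw [if_neg (by omega), pp m hm, pp n hn]
    exact ww _ _

/-- `φ_{-n} |0⟩ = 0` for `n > 0`. -/
theorem phi_neg_vac (n : ℤ) (hn : n < 0) : phi n (vac R) = 0 := by
  have h1 : ¬ 0 < n := by omega
  have h2 : n ≠ 0 := by omega
  simp [phi, h1, h2, contr, CliffordAlgebra.contractLeft_one]

/-- `⟨0| φ_n = 0` for `n > 0`. -/
theorem vev_phi_pos (n : ℤ) (hn : 0 < n) (v : Fock R) : vev (phi n v) = 0 := by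
  simp [phi, hn, wedge, vev, ExteriorAlgebra.algebraMapInv]

theorem vev_vac : vev (vac R) = 1 := by simp [vev]

theorem vev_phi_zero_vac : vev (phi 0 (vac R)) = 0 := by
  simp [phi, wedge, contr, vev, ExteriorAlgebra.algebraMapInv, CliffordAlgebra.contractLeft_one]

end Fermions

/-! ### Deformed operators on the Fock space

`R` is a commutative `ℚ`-algebra, `β` an element of it and `p 1, p 2, …` are the elements that
stand for the power sums. All infinite sums below have only finitely many nonzero terms once they
are applied to a vector of the Fock space. -/

section Operators

variable {R : Type*} [CommRing R] [Algebra ℚ R]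

/-- The power series `1 / (1 - c X)`. -/
def geom (c : R) : PowerSeries R := PowerSeries.mk fun k => c ^ k

theorem geom_mul {S : Type*} [CommRing S] (c : S) :
    (PowerSeries.mk fun k => c ^ k) * (1 - PowerSeries.C c * PowerSeries.X) = 1 := by
  ext n
  rw [mul_sub, mul_one, mul_left_comm, map_sub, PowerSeries.coeff_C_mul]
  cases n with
  | zero => simp
  | succ n => simp [PowerSeries.coeff_succ_mul_X, PowerSeries.coeff_one, pow_succ']

/-- The Heisenberg generator `b_m = (1/4) ∑_{i ∈ ℤ} (-1)^i φ_{-i-m} φ_i` (for odd `m`). -/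
def heis (m : ℤ) (v : Fock R) : Fock R :=
  algebraMap ℚ R (1 / 4) • ∑ᶠ i : ℤ, (-1 : R) ^ i.natAbs • phi (-i - m) (phi i v)

/-- The coefficient of `φ_m` in the deformed fermion `φ^{(β)}_n`, where
`∑_{n ≥ 0} φ^{(β)}_n z^n = ∑_{m ≥ 0} φ_m (z + β/2)^m` and
`∑_{n > 0} φ^{(β)}_{-n} z^{-n} = ∑_{m > 0} φ_{-m} (z⁻¹ / (1 + (β/2) z⁻¹))^m`. -/
def phiBetaCoeff (β : R) (n m : ℤ) : R :=
  if 0 ≤ n ∧ 0 ≤ m then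
    PowerSeries.coeff n.toNat
      ((PowerSeries.X + PowerSeries.C (algebraMap ℚ R (1 / 2) * β)) ^ m.toNat)
  else if n < 0 ∧ m < 0 then
    PowerSeries.coeff n.natAbs
      ((PowerSeries.X * geom (-(algebraMap ℚ R (1 / 2) * β))) ^ m.natAbs)
  else 0

/-- The dual deformed fermion `φ^{[β]}_n = (-1)^n (φ^{(-β)}_{-n})^*`, where `*` is the linear
anti-involution with `φ_m^* = (-1)^m φ_{-m}`. -/
def dphi (β : R) (n : ℤ) (v : Fock R) : Fock R :=
  ∑ᶠ m : ℤ, ((-1 : R) ^ n.natAbs * phiBetaCoeff (-β) (-n) m * (-1 : R) ^ m.natAbs) • phi (-m) v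

/-- The coefficient of `b_{-k}` in `b^{(β)}_{-n}` for `n ≥ 1`, i.e. the coefficient of `X^{-k}` in
the expansion of `((X - β/2)^{-n} - (-X - β/2)^{-n}) / 2` in powers of `u = X⁻¹`; here
`(X - β/2)⁻¹ = u / (1 - (β/2) u)` and `(-X - β/2)⁻¹ = -u / (1 + (β/2) u)`. -/
def heisBetaCoeff (β : R) (n k : ℕ) : R :=
  algebraMap ℚ R (1 / 2) * PowerSeries.coeff k
    ((PowerSeries.X * geom (algebraMap ℚ R (1 / 2) * β)) ^ n -
      (-(PowerSeries.X * geom (-(algebraMap ℚ R (1 / 2) * β)))) ^ n)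

/-- The operator `b^{[β]}_n = (b^{(β)}_{-n})^*` for `n ≥ 1`; recall `b_{-k}^* = b_k`, and only odd
`k` occur. -/
def dheis (β : R) (n : ℕ) (v : Fock R) : Fock R :=
  ∑ᶠ k : ℕ, heisBetaCoeff β n k • heis (k : ℤ) v

/-- The operator `H^{[β]} = 2 ∑_{n ≥ 1} (p_n / n) b^{[β]}_n`. -/
def dHam (β : R) (p : ℕ → R) (v : Fock R) : Fock R :=
  ∑ᶠ n : ℕ, (algebraMap ℚ R (2 / ((n : ℚ) + 1)) * p (n + 1)) • dheis β (n + 1) v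

/-- The operator `θ = 2 ((β/2) b_1 + (β/2)^3 b_3 / 3 + (β/2)^5 b_5 / 5 + ⋯)`. -/
def theta (β : R) (v : Fock R) : Fock R :=
  ∑ᶠ n : ℕ, (algebraMap ℚ R (2 / (2 * (n : ℚ) + 1)) *
    (algebraMap ℚ R (1 / 2) * β) ^ (2 * n + 1)) • heis (2 * (n : ℤ) + 1) v

/-- The exponential `∑_m A^m / m!` of a locally nilpotent operator `A`. -/
def expOp (A : Fock R → Fock R) (v : Fock R) : Fock R :=
  ∑ᶠ m : ℕ, algebraMap ℚ R (1 / (m.factorial : ℚ)) • A^[m] v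

/-- The vector `|n_1, …, n_r⟩^g = e^{-θ} φ^{[β]}_{n_1} e^{-θ} φ^{[β]}_{n_2} ⋯ e^{-θ} φ^{[β]}_{n_r} |0⟩`. -/
def ketg (β : R) : List ℕ → Fock R
  | [] => vac R
  | n :: l => expOp (fun v => -theta β v) (dphi β (n : ℤ) (ketg β l))

/-- The dual function `o_λ` attached to a sequence `λ = (λ_1, …, λ_r)`:
`2^{-r} ⟨0| e^{H^{[β]}} |λ_1, …, λ_r⟩^g` for even `r` and
`2^{-r} ⟨0| e^{H^{[β]}} |λ_1, …, λ_r, 0⟩^g` for odd `r`. -/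
def dualO (β : R) (p : ℕ → R) (lam : List ℕ) : R :=
  algebraMap ℚ R ((1 / 2) ^ lam.length) *
    vev (expOp (dHam β p) (ketg β (if Even lam.length then lam else lam ++ [0])))

end Operators

/-! ### Functions of the variables `x_0, x_1, x_2, …` -/

section Symmetric

/-- The field `k = ℚ(β)`. -/
abbrev K : Type := RatFunc ℚ

/-- The parameter `β` as an element of `ℚ(β)`. -/
abbrev betaK : K := RatFunc.X

/-- Formal power series in countably many variables over `k = ℚ(β)`; the symmetric functions over
`k` are elements of this ring. -/
abbrev Ser : Type := MvPowerSeries ℕ K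

/-- The parameter `β` as a constant power series. -/
def betaS : Ser := MvPowerSeries.C betaK

/-- The power sum `p_n(x) = ∑_i x_i^n` for `n ≥ 1`. -/
def powerSum (n : ℕ) : Ser := fun d =>
  open Classical in if ∃ i : ℕ, d = Finsupp.single i n then 1 else 0

/-- The dual function `o_λ(x)`. -/
def oFun (lam : List ℕ) : Ser := dualO betaS powerSum lam

/-- The series `z̄ = -z / (1 + β z)`. -/
def zbar : PowerSeries Ser := -(PowerSeries.X * geom (-betaS))

/-- The factor `(1 - x_i z̄) / (1 - x_i z)`. -/
def qFactor (i : ℕ) : PowerSeries Ser :=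
  (1 - PowerSeries.C (MvPowerSeries.X i) * zbar) * geom (MvPowerSeries.X i)

/-- The function `q^{[β]}_n(x)`, `n ≥ 0`: the coefficient of `z^n` in the infinite product
`∏_i (1 - x_i z̄) / (1 - x_i z)`. The coefficient of a monomial `x^d` in it is read off from the
finitely many factors whose variable occurs in `x^d`; by `coeff_prod_qFactor`, every larger finite
partial product gives the same coefficient. -/
def qNat (n : ℕ) : Ser := fun d =>
  MvPowerSeries.coeff d (PowerSeries.coeff n (∏ i ∈ d.support, qFactor i))

theorem coeff_prod_qFactor (n : ℕ) (d : ℕ →₀ ℕ) (s : Finset ℕ) (hs : d.support ⊆ s) :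
    MvPowerSeries.coeff d (PowerSeries.coeff n (∏ i ∈ s, qFactor i)) =
      MvPowerSeries.coeff d (qNat n) := by
  classical
  have key : ∀ (f : PowerSeries Ser) (i : ℕ), d i = 0 →
      MvPowerSeries.coeff d (PowerSeries.coeff n (f * qFactor i)) =
        MvPowerSeries.coeff d (PowerSeries.coeff n f) := by
    intro f i hi
    have h1 : qFactor i = 1 + PowerSeries.C (MvPowerSeries.X i) *
        ((PowerSeries.X - zbar) * geom (MvPowerSeries.X i)) := by
      have h := geom_mul (MvPowerSeries.X i : Ser)
      change geom (MvPowerSeries.X i : Ser) * _ = 1 at h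
      unfold qFactor
      linear_combination h
    rw [h1, mul_add, mul_one, mul_left_comm, map_add, PowerSeries.coeff_C_mul, map_add,
      MvPowerSeries.X, MvPowerSeries.coeff_monomial_mul, if_neg, add_zero]
    intro hle
    have := hle i
    simp [hi] at this
  have key2 : ∀ (t : Finset ℕ) (f : PowerSeries Ser), (∀ i ∈ t, d i = 0) →
      MvPowerSeries.coeff d (PowerSeries.coeff n (f * ∏ i ∈ t, qFactor i)) =
        MvPowerSeries.coeff d (PowerSeries.coeff n f) := by
    intro t
    induction t using Finset.induction_on with
    | empty => intro f _; simp
    | insert a t ha ih =>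
      intro f hf
      rw [Finset.prod_insert ha, ← mul_assoc,
        ih _ (fun i hi => hf i (Finset.mem_insert_of_mem hi)),
        key _ _ (hf a (Finset.mem_insert_self a t))]
  change _ = MvPowerSeries.coeff d (PowerSeries.coeff n (∏ i ∈ d.support, qFactor i))
  rw [← Finset.prod_sdiff hs, mul_comm]
  exact key2 _ _ fun i hi => by simpa using (Finset.mem_sdiff.1 hi).2

/-- `q^{[β]}_n(x)` for `n ∈ ℤ`, with the convention `q^{[β]}_n = 0` for `n < 0`. -/
def qBeta (n : ℤ) : Ser := if 0 ≤ n then qNat n.toNat else 0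

/-- The iterated Laurent series field `k((z))((w))`. -/
abbrev LL : Type := LaurentSeries (LaurentSeries K)

/-- The variable `z` of `k((z))((w))`. -/
def zL : LL := HahnSeries.C (HahnSeries.single (1 : ℤ) (1 : K))

/-- The variable `w` of `k((z))((w))`. -/
def wL : LL := HahnSeries.single (1 : ℤ) (1 : LaurentSeries K)

/-- The parameter `β` in `k((z))((w))`. -/
def betaL : LL := HahnSeries.C (HahnSeries.C betaK)

/-- The coefficient `g^{i,j}_{p,q}` of `z^p w^q` in the expansion of
`(1 + β z)^{-i} (1 + β w)^{-j} (z - w) / (z + w + β z w)` in `k((z))((w))`, that is, on the region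
`|w| < |z|`. -/
def gCoeff (i j : ℕ) (p q : ℤ) : K :=
  HahnSeries.coeff (HahnSeries.coeff
    (((1 + betaL * zL) ^ i)⁻¹ * ((1 + betaL * wL) ^ j)⁻¹ *
      ((zL - wL) / (zL + wL + betaL * zL * wL))) q) p

/-- The coefficient `g^{i,r+1}_p` of `z^p` in the power series `(1 + β z)^{-i}`. -/
def gLast (i p : ℕ) : K :=
  PowerSeries.coeff p ((((1 : PowerSeries K) + PowerSeries.C betaK * PowerSeries.X) ^ i)⁻¹)

/-- The part `λ_i`, counted from `i = 1`. -/
def part (lam : List ℕ) (i : ℕ) : ℤ := (lam.getD (i - 1) 0 : ℕ)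

/-- The entry `ζ_{i,j}`, `1 ≤ i < j`, for a sequence `λ` of length `r`. The sums are finite because
`q^{[β]}_n = 0` for `n < 0`. -/
def zeta (lam : List ℕ) (i j : ℕ) : Ser :=
  if j = lam.length + 1 then
    ∑ᶠ p : ℕ, MvPowerSeries.C (gLast i p) * qBeta (part lam i - p)
  else
    ∑ᶠ pq : {pq : ℤ × ℤ // 0 ≤ pq.1 + pq.2 ∧ 0 ≤ pq.2},
      MvPowerSeries.C (gCoeff i j pq.1.1 pq.1.2) *
        (qBeta (part lam i - pq.1.1) * qBeta (part lam j - pq.1.2))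

end Symmetric

end DualKQ

end

/-! Attach to a Laurent series f = Σ f_n t^n the operator Φ(f) = Σ f_n φ_{-n} (`field`). For odd m,
[b_m, φ_n] = φ_{n-m} (`heisLin_phi`), so commuting with b_m multiplies f by t^m. As b_m kills the
vacuum for m > 0, the exponential of Σ h_k b_k, with h odd, replaces every factor of
Φ(f_1)⋯Φ(f_n)|0⟩ by Φ(e^h f_i) (`expOp_heisSum_word`). A fixed vector is killed by Φ(f) for all f of
large order, so every infinite sum is truncated to a finite one.

Put c = β/2 and z = t/(1 - ct). Then 1 + βz = (1 + ct)/(1 - ct), and t ↦ -t is the involution z ↦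
z̄. All ingredients become multiplications: φ^{[β]}_n is Φ(z^{-n}/(1 - ct)) (`dphi_eq_field`),
e^{-θ} multiplies by (1 + βz)^{-1} (`expSeries_thetaSeries`, `eSeries_mul`), and e^H by exp Σ p_n
(z^n - z̄^n)/n = Σ q_n z^n = Q(z) (`expSeries_hamSeries`, `coeff_qSeries`). Hence o_λ is 2^{-r}
times the vacuum expectation value of the product of the Φ(F_i), F_i = Q(z)(1 + βz)^{-i} z^{-λ_i}/(1
- ct), and Wick's theorem (`vev_word_two_mul`) makes it a Pfaffian of two-point functions
(`dualO_eq_pfaffian`).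

Expanding both copies of Q gives the entries Σ q_k q_l g(λ_i - k, λ_j - l), where g is `pairCoeff`,
the two-point function without Q (`twoPoint_subst`). It is the required coefficient: the factors 1 +
βz and 1 + βw give recursions in i and j, and for i = j = 0 the shift identity `twoPoint_shift` says
that the generating series times z + w + βzw is z - w; in the field k((z))((w)) these equations have
one solution (`coeff_expansion_eq_pairCoeff`). Orders in t give the support condition, and the same
two-point functions computed over ℚ[β] give integrality (`map_pairCoeff`).

In the column j = r + 1 the second series is a power series in t with constant term 1. The pairing
then reads off the t^0-coefficient of F_i, which is the coefficient of z^{λ_i} in Q(z)(1 + βz)^{-i}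
(`twoPoint_subst_zero`); r = 1 is the one-row formula. -/

noncomputable section

namespace DualKQ

/-! ### Expansion of a Pfaffian along its first row -/

section PfaffianExpansion

variable {R : Type*} [CommRing R]

/-- The permutations over which a Pfaffian is summed. -/
def IsPfPerm {m : ℕ} (σ : Equiv.Perm (Fin (2 * m))) : Prop :=
  (∀ s t : Fin m, s < t → σ ⟨2 * s.val, by omega⟩ < σ ⟨2 * t.val, by omega⟩) ∧
    (∀ t : Fin m, σ ⟨2 * t.val, by omega⟩ < σ ⟨2 * t.val + 1, by omega⟩)

/-- The summand of a Pfaffian. -/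
def pfTerm {m : ℕ} (a : Fin (2 * m) → Fin (2 * m) → R) (σ : Equiv.Perm (Fin (2 * m))) : R :=
  ((Equiv.Perm.sign σ : ℤ) : R) *
    ∏ t : Fin m, a (σ ⟨2 * t.val, by omega⟩) (σ ⟨2 * t.val + 1, by omega⟩)

open Classical in
theorem pfaffian_eq_sum_filter (m : ℕ) (a : Fin (2 * m) → Fin (2 * m) → R) :
    pfaffian m a = ∑ σ with IsPfPerm σ, pfTerm a σ := by
  rw [Finset.sum_filter]
  unfold pfaffian IsPfPerm pfTerm
  refine Finset.sum_congr rfl fun σ _ => ?_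
  congr

theorem pfaffian_congr {m : ℕ} {a b : Fin (2 * m) → Fin (2 * m) → R}
    (h : ∀ i j, i < j → a i j = b i j) : pfaffian m a = pfaffian m b := by
  classical
  rw [pfaffian_eq_sum_filter, pfaffian_eq_sum_filter]
  refine Finset.sum_congr rfl fun σ hσ => ?_
  rw [Finset.mem_filter] at hσ
  unfold pfTerm
  congr 1
  exact Finset.prod_congr rfl fun t _ => h _ _ (hσ.2.2 t)

theorem pfaffian_zero (a : Fin (2 * 0) → Fin (2 * 0) → R) : pfaffian 0 a = 1 := by
  classical
  rw [pfaffian_eq_sum_filter, Finset.filter_true_of_mem]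
  · have : Fintype.card (Equiv.Perm (Fin (2 * 0))) = 1 := by simp
    obtain ⟨σ, hσ⟩ := Fintype.card_eq_one_iff.1 this
    rw [show (Finset.univ : Finset (Equiv.Perm (Fin (2 * 0)))) = {σ} from
      Finset.eq_singleton_iff_unique_mem.2 ⟨Finset.mem_univ _, fun x _ => hσ x⟩]
    have h1 : σ = 1 := (hσ 1).symm
    subst h1
    simp [pfTerm]
  · intro σ _
    exact ⟨fun s => s.elim0, fun s => s.elim0⟩

/-- The permutation `0 ↦ 0`, `1 ↦ k + 1`, with the remaining values in the order given by `τ`. -/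
def pairPerm {n : ℕ} (k : Fin (n + 1)) (τ : Equiv.Perm (Fin n)) : Equiv.Perm (Fin (n + 2)) :=
  Equiv.Perm.decomposeFin.symm
    (0, (k.cycleRange)⁻¹ * Equiv.Perm.decomposeFin.symm (0, τ))

theorem pairPerm_zero {n : ℕ} (k : Fin (n + 1)) (τ : Equiv.Perm (Fin n)) :
    pairPerm k τ 0 = 0 := by
  simp [pairPerm]

theorem pairPerm_one {n : ℕ} (k : Fin (n + 1)) (τ : Equiv.Perm (Fin n)) :
    pairPerm k τ 1 = k.succ := by
  rw [← Fin.succ_zero_eq_one, pairPerm, Equiv.Perm.decomposeFin_symm_apply_succ]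
  simp [Equiv.Perm.inv_def]

theorem pairPerm_succ_succ {n : ℕ} (k : Fin (n + 1)) (τ : Equiv.Perm (Fin n)) (i : Fin n) :
    pairPerm k τ i.succ.succ = (k.succAbove (τ i)).succ := by
  rw [pairPerm, Equiv.Perm.decomposeFin_symm_apply_succ]
  simp [Equiv.Perm.inv_def, Equiv.Perm.decomposeFin_symm_apply_succ]

theorem pairPerm_even_succ {m : ℕ} (k : Fin (2 * m + 1)) (τ : Equiv.Perm (Fin (2 * m)))
    (t : Fin m) :
    pairPerm k τ ⟨2 * ((t.succ : Fin (m + 1)) : ℕ), by simp; omega⟩ =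
      (k.succAbove (τ ⟨2 * t.val, by omega⟩)).succ :=
  (congrArg (pairPerm k τ) (Fin.ext (by simp; omega))).trans
    (pairPerm_succ_succ k τ ⟨2 * t.val, by omega⟩)

theorem pairPerm_odd_succ {m : ℕ} (k : Fin (2 * m + 1)) (τ : Equiv.Perm (Fin (2 * m)))
    (t : Fin m) :
    pairPerm k τ ⟨2 * ((t.succ : Fin (m + 1)) : ℕ) + 1, by have := t.2; simp⟩ =
      (k.succAbove (τ ⟨2 * t.val + 1, by omega⟩)).succ :=
  (congrArg (pairPerm k τ) (Fin.ext (by simp; omega))).trans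
    (pairPerm_succ_succ k τ ⟨2 * t.val + 1, by omega⟩)

theorem sign_pairPerm {n : ℕ} (k : Fin (n + 1)) (τ : Equiv.Perm (Fin n)) :
    Equiv.Perm.sign (pairPerm k τ) = (-1) ^ (k : ℕ) * Equiv.Perm.sign τ := by
  simp [pairPerm]

theorem exists_pairPerm {n : ℕ} (σ : Equiv.Perm (Fin (n + 2))) (h : σ 0 = 0) :
    ∃ k τ, pairPerm k τ = σ := by
  obtain ⟨⟨p, ρ⟩, rfl⟩ := Equiv.Perm.decomposeFin.symm.surjective σ
  have hp : p = 0 := by simpa using h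
  subst hp
  -- The cycle carries ρ 0 back to 0, so what remains fixes 0 and comes from a permutation τ of the
  -- other points.
  obtain ⟨⟨q, τ⟩, hτ⟩ := Equiv.Perm.decomposeFin.symm.surjective ((ρ 0).cycleRange * ρ)
  have hq : q = 0 := by
    have := congrArg (fun e => e 0) hτ
    simpa using this
  subst hq
  exact ⟨ρ 0, τ, by rw [pairPerm, hτ, inv_mul_cancel_left]⟩

theorem pairPerm_injective {n : ℕ} :
    Function.Injective fun x : Fin (n + 1) × Equiv.Perm (Fin n) => pairPerm x.1 x.2 := by
  rintro ⟨k, τ⟩ ⟨k', τ'⟩ h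
  have hk : k = k' := by
    have := congrArg (fun e => e 1) h
    simpa [pairPerm_one] using this
  subst hk
  simpa [pairPerm] using h

theorem isPfPerm_pairPerm {m : ℕ} (k : Fin (2 * m + 1)) (τ : Equiv.Perm (Fin (2 * m))) :
    IsPfPerm (m := m + 1) (pairPerm k τ) ↔ IsPfPerm τ := by
  have e0 : pairPerm k τ ⟨2 * ((0 : Fin (m + 1)) : ℕ), by omega⟩ = 0 := pairPerm_zero k τ
  have e1 : pairPerm k τ ⟨2 * ((0 : Fin (m + 1)) : ℕ) + 1, by omega⟩ = k.succ := pairPerm_one k τ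
  have es := pairPerm_even_succ k τ
  have es' := pairPerm_odd_succ k τ
  constructor
  · rintro ⟨h1, h2⟩
    refine ⟨fun s t hst => ?_, fun t => ?_⟩
    · have := h1 s.succ t.succ (by simpa using hst)
      rw [es, es] at this
      simpa using this
    · have := h2 t.succ
      rw [es, es'] at this
      simpa using this
  · rintro ⟨h1, h2⟩
    refine ⟨fun s t hst => ?_, fun t => ?_⟩
    · induction t using Fin.cases with
      | zero => simp at hst
      | succ t =>
        induction s using Fin.cases with
        | zero =>
          rw [e0, es]
          exact Fin.succ_pos _
        | succ s =>
          rw [es, es]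
          simpa using h1 s t (by simpa using hst)
    · induction t using Fin.cases with
      | zero =>
        rw [e0, e1]
        exact Fin.succ_pos _
      | succ t =>
        rw [es, es']
        simpa using h2 t

/-- The value 0 cannot stand at a later even position, where position 0 would hold something
smaller, nor at an odd one, where its left partner would. -/
theorem IsPfPerm.apply_zero {m : ℕ} {σ : Equiv.Perm (Fin (2 * (m + 1)))} (h : IsPfPerm σ) :
    σ 0 = 0 := by
  obtain ⟨j, hj⟩ := σ.surjective 0
  rcases Nat.even_or_odd' j.val with ⟨t, ht | ht⟩
  · by_cases h0 : t = 0
    · have : j = 0 := Fin.ext (by simp [ht, h0])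
      rwa [this] at hj
    · have := h.1 0 ⟨t, by omega⟩ (by simp [Fin.lt_def]; omega)
      rw [show (⟨2 * ((⟨t, by omega⟩ : Fin (m + 1)) : ℕ), by simp; omega⟩ : Fin (2 * (m + 1))) = j
        from Fin.ext ht.symm, hj] at this
      exact absurd this (Fin.not_lt_zero _)
  · have := h.2 ⟨t, by omega⟩
    rw [show (⟨2 * ((⟨t, by omega⟩ : Fin (m + 1)) : ℕ) + 1, by simp; omega⟩ : Fin (2 * (m + 1))) = j
      from Fin.ext ht.symm, hj] at this
    exact absurd this (Fin.not_lt_zero _)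

theorem pfTerm_pairPerm {m : ℕ} (a : Fin (2 * m + 2) → Fin (2 * m + 2) → R)
    (k : Fin (2 * m + 1)) (τ : Equiv.Perm (Fin (2 * m))) :
    pfTerm (m := m + 1) a (pairPerm k τ) = (-1) ^ (k : ℕ) * a 0 k.succ *
      pfTerm (fun i j => a (k.succAbove i).succ (k.succAbove j).succ) τ := by
  have e0 : pairPerm k τ ⟨2 * ((0 : Fin (m + 1)) : ℕ), by omega⟩ = 0 := pairPerm_zero k τ
  have e1 : pairPerm k τ ⟨2 * ((0 : Fin (m + 1)) : ℕ) + 1, by omega⟩ = k.succ := pairPerm_one k τ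
  have es := pairPerm_even_succ k τ
  have es' := pairPerm_odd_succ k τ
  unfold pfTerm
  rw [Fin.prod_univ_succ, e0, e1]
  simp only [es, es']
  rw [show Equiv.Perm.sign (α := Fin (2 * (m + 1))) (pairPerm k τ) = _ from sign_pairPerm k τ]
  push_cast
  ring

/-- Expansion along the first row: an admissible σ fixes 0, hence amounts to the partner k + 1 of 0
and an admissible permutation of the remaining points; moving the partner into place gives the sign
(-1)^k. -/
theorem pfaffian_succ (m : ℕ) (a : Fin (2 * m + 2) → Fin (2 * m + 2) → R) :
    pfaffian (m + 1) a = ∑ k : Fin (2 * m + 1), (-1) ^ (k : ℕ) * a 0 k.succ *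
      pfaffian m (fun i j => a (k.succAbove i).succ (k.succAbove j).succ) := by
  classical
  simp_rw [pfaffian_eq_sum_filter m, Finset.mul_sum]
  rw [pfaffian_eq_sum_filter, ← Finset.sum_product']
  symm
  refine Finset.sum_bij (fun x _ => pairPerm x.1 x.2) ?_ ?_ ?_ ?_
  · rintro ⟨k, τ⟩ h
    simpa [isPfPerm_pairPerm] using h
  · rintro x _ y _ h
    exact pairPerm_injective h
  · intro σ hσ
    have h1 : IsPfPerm (m := m + 1) σ := by simpa using hσ
    obtain ⟨k, τ, rfl⟩ := exists_pairPerm (n := 2 * m) σ h1.apply_zero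
    exact ⟨(k, τ), by simpa [isPfPerm_pairPerm] using h1, rfl⟩
  · rintro ⟨k, τ⟩ _
    exact (pfTerm_pairPerm a k τ).symm

end PfaffianExpansion

/-! ### Field operators with Laurent series coefficients -/

section Fields

variable {R : Type*} [CommRing R]

/-- The norm `⟨0| φ_{-m} φ_m |0⟩` of a mode. -/
def modeNorm (R : Type*) [CommRing R] (m : ℕ) : R := if m = 0 then 1 else 2 * (-1) ^ m

theorem finite_support_coeff_neg (f : LaurentSeries R) :
    (Function.support fun n : ℕ => f.coeff (-n)).Finite := by
  refine (Set.finite_Iic f.order.natAbs).subset fun n hn => ?_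
  by_contra h
  simp only [Set.mem_Iic, not_le] at h
  exact hn (HahnSeries.coeff_eq_zero_of_lt_order (by omega))

/-- The creation part of a field operator. -/
def creation : LaurentSeries R →ₗ[R] (ℕ →₀ R) where
  toFun f := Finsupp.ofSupportFinite (fun n => f.coeff (-n)) (finite_support_coeff_neg f)
  map_add' f g := by ext n; simp [Finsupp.ofSupportFinite_coe]
  map_smul' r f := by ext n; simp [Finsupp.ofSupportFinite_coe]

@[simp]
theorem creation_apply (f : LaurentSeries R) (n : ℕ) : creation f n = f.coeff (-n) := rfl

/-- The annihilation part of a field operator. -/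
def annihilation : LaurentSeries R →ₗ[R] Module.Dual R (ℕ →₀ R) where
  toFun f := Finsupp.linearCombination R fun m : ℕ => modeNorm R m * f.coeff m
  map_add' f g := by ext n; simp [mul_add]
  map_smul' r f := by ext n; simp [mul_left_comm]

theorem annihilation_apply (f : LaurentSeries R) (x : ℕ →₀ R) :
    annihilation f x = x.sum fun m r => r * (modeNorm R m * f.coeff m) := by
  simp [annihilation, Finsupp.linearCombination_apply]

/-- The field operator `∑_n f_n φ_{-n}` attached to the Laurent series `f = ∑_n f_n t^n`. -/
def field : LaurentSeries R →ₗ[R] Module.End R (Fock R) :=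
  LinearMap.mul R (Fock R) ∘ₗ ExteriorAlgebra.ι R ∘ₗ creation +
    CliffordAlgebra.contractLeft ∘ₗ annihilation

theorem field_apply (f : LaurentSeries R) (v : Fock R) :
    field f v = ExteriorAlgebra.ι R (creation f) * v +
      CliffordAlgebra.contractLeft (annihilation f) v := rfl

/-- The two-point function `⟨0| Φ(f) Φ(g) |0⟩`. -/
def twoPoint (f g : LaurentSeries R) : R := annihilation f (creation g)

theorem twoPoint_eq_sum_range (f g : LaurentSeries R) (N : ℕ)
    (h : ∀ m : ℕ, N ≤ m → g.coeff (-m) = 0) :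
    twoPoint f g = ∑ m ∈ Finset.range N, modeNorm R m * f.coeff m * g.coeff (-m) := by
  rw [twoPoint, annihilation_apply, Finsupp.sum_of_support_subset (s := Finset.range N)]
  · exact Finset.sum_congr rfl fun m _ => by rw [creation_apply]; ring
  · intro m hm
    by_contra h'
    simp only [Finset.mem_range, not_lt] at h'
    simp [h m h'] at hm
  · simp

theorem contr_ι_mul (d : Module.Dual R (ℕ →₀ R)) (x : ℕ →₀ R) (v : Fock R) :
    (CliffordAlgebra.contractLeft d (ExteriorAlgebra.ι R x * v) : Fock R) =
      d x • v - ExteriorAlgebra.ι R x * CliffordAlgebra.contractLeft d v :=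
  CliffordAlgebra.contractLeft_ι_mul (Q := (0 : QuadraticForm R (ℕ →₀ R)))
    (d := d) x v

/-- Contractions anticommute with each other, so only the creation part of Φ(g) contributes a
scalar. -/
theorem annihilation_field (f g : LaurentSeries R) (v : Fock R) :
    (CliffordAlgebra.contractLeft (annihilation f) (field g v) : Fock R) =
      twoPoint f g • v - field g (CliffordAlgebra.contractLeft (annihilation f) v : Fock R) := by
  rw [field_apply, field_apply, map_add, contr_ι_mul, CliffordAlgebra.contractLeft_comm, twoPoint]
  abel

theorem vev_smul (r : R) (v : Fock R) : vev (r • v) = r * vev v := by simp [vev]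

/-- The creation part lands in positive exterior degree, which the vacuum expectation value ignores.
-/
theorem vev_field (f : LaurentSeries R) (v : Fock R) :
    vev (field f v) = vev (CliffordAlgebra.contractLeft (annihilation f) v : Fock R) := by
  rw [field_apply]
  simp [vev, ExteriorAlgebra.algebraMapInv]

theorem field_single (n : ℤ) (r : R) :
    field (HahnSeries.single n r) = r • phi (R := R) (-n) := by
  have hc : ∀ m : ℕ, creation (HahnSeries.single n r) m = if n = -m then r else 0 := by
    intro m
    rw [creation_apply, HahnSeries.coeff_single]
    simp only [eq_comm]
  have ha : annihilation (HahnSeries.single n r) =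
      if 0 ≤ n then (r * modeNorm R n.toNat) • Finsupp.lapply n.toNat else 0 := by
    ext m
    simp only [annihilation, LinearMap.coe_mk, AddHom.coe_mk, LinearMap.comp_apply,
      Finsupp.lsingle_apply, Finsupp.linearCombination_single, one_smul, HahnSeries.coeff_single]
    split_ifs with h1 h2 h2
    · subst h1; simp [mul_comm]
    · omega
    · have : n.toNat ≠ m := by omega
      simp [this.symm]
    · simp
  refine LinearMap.ext fun v => ?_
  rw [field_apply, ha]
  rcases lt_trichotomy n 0 with h | h | h
  · have hx : creation (HahnSeries.single n r) = r • Finsupp.single (-n).toNat (1 : R) := by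
      ext m
      rw [hc, Finsupp.smul_apply, Finsupp.single_apply]
      split_ifs <;> first | omega | simp
    rw [hx, map_smul, smul_mul_assoc, if_neg (by omega), phi, if_pos (by omega)]
    simp [wedge]
  · subst h
    have hx : creation (HahnSeries.single 0 r) = r • Finsupp.single 0 (1 : R) := by
      ext m
      rw [hc, Finsupp.smul_apply, Finsupp.single_apply]
      split_ifs <;> first | omega | simp
    rw [hx, map_smul, smul_mul_assoc]
    simp [phi, wedge, contr, modeNorm]
  · have hx : creation (HahnSeries.single n r) = 0 := by
      ext m
      rw [hc, if_neg (by omega)]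
      rfl
    have e : (-n).natAbs = n.toNat := by omega
    rw [hx, if_pos h.le, phi, if_neg (by omega), if_neg (by omega), e, modeNorm, if_neg (by omega)]
    simp [contr, smul_smul]

/-- A vector is annihilated by all fields with coefficients of large order. -/
theorem exists_field_eq_zero (v : Fock R) :
    ∃ N : ℕ, ∀ f : LaurentSeries R, (∀ n : ℤ, n < N → f.coeff n = 0) → field f v = 0 := by
  -- This settles the annihilation part: a vector involves finitely many basis vectors, and a
  -- functional vanishing on those contracts it to zero.
  have key : ∃ N : ℕ, ∀ d : Module.Dual R (ℕ →₀ R), (∀ n < N, d (Finsupp.single n 1) = 0) →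
      (CliffordAlgebra.contractLeft d v : Fock R) = 0 := by
    induction v using CliffordAlgebra.left_induction with
    | algebraMap r => exact ⟨0, fun d _ => CliffordAlgebra.contractLeft_algebraMap _ _ r⟩
    | add x y hx hy =>
      obtain ⟨M, hM⟩ := hx
      obtain ⟨N, hN⟩ := hy
      refine ⟨max M N, fun d hd => ?_⟩
      rw [map_add, hM d fun n hn => hd n (lt_max_of_lt_left hn),
        hN d fun n hn => hd n (lt_max_of_lt_right hn), add_zero]
    | ι_mul x m hx =>
      obtain ⟨M, hM⟩ := hx
      refine ⟨max M (m.support.sup id + 1), fun d hd => ?_⟩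
      have hm : d m = 0 := by
        rw [← m.sum_single, map_finsuppSum]
        refine Finset.sum_eq_zero fun n hn => ?_
        have h1 : n ≤ m.support.sup id := Finset.le_sup (f := id) hn
        have h2 := hd n (lt_max_of_lt_right (by omega))
        beta_reduce
        rw [show Finsupp.single n (m n) = m n • Finsupp.single n (1 : R) by simp, map_smul, h2,
          smul_zero]
      rw [CliffordAlgebra.contractLeft_ι_mul, hm, hM d fun n hn => hd n (lt_max_of_lt_left hn)]
      simp
  obtain ⟨N, hN⟩ := key
  -- The extra 1 makes the threshold positive, so that the creation part, which includes the
  -- coefficient of t^0, vanishes too.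
  refine ⟨N + 1, fun f hf => ?_⟩
  have hc : creation f = 0 := by
    ext n
    rw [creation_apply, hf _ (by push_cast; omega)]
    rfl
  rw [field_apply, hc, hN]
  · simp
  · intro n hn
    simp [annihilation, hf n (by push_cast; omega)]

/-- The vector `Φ(f_1) ⋯ Φ(f_n) |0⟩`. -/
def word : (n : ℕ) → (Fin n → LaurentSeries R) → Fock R
  | 0, _ => vac R
  | n + 1, f => field (f 0) (word n fun i => f i.succ)

/-- The contraction is moved to the right: each field passed costs a sign and leaves its two-point
function, and the vacuum is killed in the end. -/
theorem contr_word (d : LaurentSeries R) (n : ℕ) (f : Fin (n + 1) → LaurentSeries R) :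
    (CliffordAlgebra.contractLeft (annihilation d) (word (n + 1) f) : Fock R) =
      ∑ k : Fin (n + 1), ((-1) ^ (k : ℕ) * twoPoint d (f k)) •
        word n fun i => f (k.succAbove i) := by
  induction n with
  | zero =>
    rw [word, annihilation_field, word, CliffordAlgebra.contractLeft_one]
    simp [word]
  | succ n ih =>
    rw [word, annihilation_field, ih, map_sum, Fin.sum_univ_succ (n := n + 1), sub_eq_add_neg,
      ← Finset.sum_neg_distrib]
    congr 1
    · simp
    · refine Finset.sum_congr rfl fun k _ => ?_
      rw [map_smul, word, ← neg_smul]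
      simp [pow_succ]

/-- Wick's theorem: under the expectation value the leftmost field acts as a contraction, and
`contr_word` is then the first-row expansion of the Pfaffian. -/
theorem vev_word_two_mul (m : ℕ) (f : Fin (2 * m) → LaurentSeries R) :
    vev (word (2 * m) f) = pfaffian m fun i j => twoPoint (f i) (f j) := by
  induction m with
  | zero => rw [pfaffian_zero]; exact vev_vac
  | succ m ih =>
    rw [pfaffian_succ]
    change vev (field (f 0) (word (2 * m + 1) fun i => f i.succ)) = _
    rw [vev_field, contr_word]
    have hs : ∀ g : Fin (2 * m + 1) → Fock R, vev (∑ k, g k) = ∑ k, vev (g k) := by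
      intro g; simp [vev]
    rw [hs]
    refine Finset.sum_congr rfl fun k _ => ?_
    rw [vev_smul, ih]

end Fields

/-! ### Truncation of Laurent series -/

section Truncation

variable {R : Type*} [CommRing R]

/-- The coefficients of `f` below `L` vanish. -/
def VanishesBelow (L : ℤ) (f : LaurentSeries R) : Prop := ∀ n < L, f.coeff n = 0

theorem VanishesBelow.mono {L M : ℤ} {f : LaurentSeries R} (h : VanishesBelow L f) (hM : M ≤ L) :
    VanishesBelow M f := fun n hn => h n (hn.trans_le hM)

theorem VanishesBelow.mul {L M : ℤ} {f g : LaurentSeries R} (hf : VanishesBelow L f)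
    (hg : VanishesBelow M g) : VanishesBelow (L + M) (f * g) := by
  intro n hn
  rw [HahnSeries.coeff_mul]
  refine Finset.sum_eq_zero fun ij hij => ?_
  rw [Finset.mem_antidiagonal] at hij
  rcases lt_or_ge ij.1 L with h | h
  · rw [hf _ h, zero_mul]
  · rw [hg ij.2 (by omega), mul_zero]

theorem vanishesBelow_ofPowerSeries (f : PowerSeries R) :
    VanishesBelow 0 (HahnSeries.ofPowerSeries ℤ R f) := by
  intro n hn
  rw [PowerSeries.coeff_coe, if_pos hn]

theorem VanishesBelow.pow {f : LaurentSeries R} (hf : VanishesBelow 1 f) (n : ℕ) :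
    VanishesBelow n (f ^ n) := by
  induction n with
  | zero =>
    rw [pow_zero, ← map_one (HahnSeries.ofPowerSeries ℤ R)]
    exact vanishesBelow_ofPowerSeries 1
  | succ n ih =>
    rw [pow_succ]
    exact_mod_cast ih.mul hf

theorem vanishesBelow_one_of_constantCoeff {f : PowerSeries R}
    (h : PowerSeries.constantCoeff f = 0) :
    VanishesBelow 1 (HahnSeries.ofPowerSeries ℤ R f) := by
  intro n hn
  rw [PowerSeries.coeff_coe]
  split_ifs with h1
  · rfl
  · have : n = 0 := by omega
    subst this
    simpa using h

theorem exists_vanishesBelow (f : LaurentSeries R) : ∃ L, VanishesBelow L f :=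
  ⟨f.order, fun _ hn => HahnSeries.coeff_eq_zero_of_lt_order hn⟩

theorem vanishesBelow_single (n : ℤ) (r : R) :
    VanishesBelow n (HahnSeries.single n r : LaurentSeries R) := by
  intro m hm
  rw [HahnSeries.coeff_single, if_neg hm.ne]

/-- A Laurent series is a finite sum of monomials up to terms of large order. -/
theorem exists_trunc (f : LaurentSeries R) (N : ℤ) :
    ∃ s : Finset ℤ, (∀ n < N, f.coeff n ≠ 0 → n ∈ s) ∧
      VanishesBelow N (f - ∑ n ∈ s, HahnSeries.single n (f.coeff n)) := by
  obtain ⟨L, hL⟩ := exists_vanishesBelow f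
  have hs : ∀ n < N, f.coeff n ≠ 0 → n ∈ Finset.Ico L N := by
    intro n hn h
    rw [Finset.mem_Ico]
    exact ⟨not_lt.1 fun h' => h (hL n h'), hn⟩
  refine ⟨Finset.Ico L N, hs, fun n hn => ?_⟩
  rw [HahnSeries.coeff_sub, HahnSeries.coeff_sum]
  by_cases h : n ∈ Finset.Ico L N
  · rw [Finset.sum_eq_single_of_mem n h]
    · simp
    · intro m _ hm
      rw [HahnSeries.coeff_single, if_neg hm.symm]
  · rw [Finset.sum_eq_zero]
    · by_contra h'
      exact h (hs n hn (by simpa using h'))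
    · intro m hm
      rw [HahnSeries.coeff_single, if_neg (ne_of_mem_of_not_mem hm h).symm]

/-- Linear maps that vanish on series of large order agree if they agree on monomials. -/
theorem eq_of_eq_on_single {V : Type*} [AddCommGroup V] [Module R V]
    {A B : LaurentSeries R →ₗ[R] V} (h : ∀ n, A (HahnSeries.single n 1) = B (HahnSeries.single n 1))
    (hA : ∃ N : ℤ, ∀ f, VanishesBelow N f → A f = 0)
    (hB : ∃ N : ℤ, ∀ f, VanishesBelow N f → B f = 0) (f : LaurentSeries R) : A f = B f := by
  obtain ⟨M, hM⟩ := hA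
  obtain ⟨N, hN⟩ := hB
  obtain ⟨s, -, hs⟩ := exists_trunc f (max M N)
  have h1 := hM _ (hs.mono (le_max_left _ _))
  have h2 := hN _ (hs.mono (le_max_right _ _))
  rw [map_sub, sub_eq_zero, map_sum] at h1 h2
  rw [h1, h2]
  refine Finset.sum_congr rfl fun n _ => ?_
  have : (HahnSeries.single n (f.coeff n) : LaurentSeries R) =
      f.coeff n • HahnSeries.single n 1 := by
    ext m
    rw [HahnSeries.coeff_smul, HahnSeries.coeff_single, HahnSeries.coeff_single]
    split_ifs <;> simp
  rw [this, map_smul, map_smul, h]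

theorem exists_field_eq_zero' (v : Fock R) :
    ∃ N : ℤ, ∀ f : LaurentSeries R, VanishesBelow N f → field f v = 0 := by
  obtain ⟨N, hN⟩ := exists_field_eq_zero v
  exact ⟨N, hN⟩

theorem finsum_phi_eq_field (f : LaurentSeries R) (v : Fock R) :
    ∑ᶠ m : ℤ, f.coeff m • phi (-m) v = field f v := by
  obtain ⟨N, hN⟩ := exists_field_eq_zero' v
  obtain ⟨s, hs, hs'⟩ := exists_trunc f N
  have h1 := hN _ hs'
  rw [map_sub, LinearMap.sub_apply, sub_eq_zero] at h1
  rw [h1, finsum_eq_sum_of_support_subset (s := s), map_sum, LinearMap.sum_apply]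
  · exact Finset.sum_congr rfl fun n _ => by rw [field_single]; rfl
  · intro m hm
    by_contra hms
    refine hm ?_
    rcases lt_or_ge m N with h | h
    · have : f.coeff m = 0 := by
        by_contra h'
        exact hms (hs m h h')
      simp [this]
    · have h2 := hN _ ((vanishesBelow_single m (f.coeff m)).mono h)
      rwa [field_single] at h2

/-- The remainder is divisible by a^M, so it has order at least M and acts as zero on a fixed vector
once M is large. This is how composed series enter finite computations. -/
theorem subst_eq_sum_add {a : PowerSeries R} (ha : PowerSeries.constantCoeff a = 0)
    (f : PowerSeries R) (M : ℕ) :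
    ∃ g, f.subst a = ∑ i ∈ Finset.range M, PowerSeries.C (PowerSeries.coeff i f) * a ^ i +
      a ^ M * g := by
  have h := PowerSeries.HasSubst.of_constantCoeff_zero' ha
  refine ⟨(PowerSeries.mk fun i => PowerSeries.coeff (i + M) f).subst a, ?_⟩
  have ht : (f.trunc M : PowerSeries R) =
      ∑ i ∈ Finset.range M, PowerSeries.C (PowerSeries.coeff i f) * PowerSeries.X ^ i := by
    ext n
    simp [PowerSeries.coeff_trunc, PowerSeries.coeff_X_pow]
  conv_lhs => rw [PowerSeries.eq_X_pow_mul_shift_add_trunc M f, ht]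
  rw [PowerSeries.subst_add h, PowerSeries.subst_mul h, PowerSeries.subst_pow h,
    PowerSeries.subst_X h, add_comm, ← PowerSeries.coe_substAlgHom h, map_sum]
  congr 1
  refine Finset.sum_congr rfl fun i _ => ?_
  rw [map_mul, map_pow, PowerSeries.coe_substAlgHom h, PowerSeries.subst_X h,
    PowerSeries.subst_C]
  rfl

/-- Multiplication by a Laurent series as a linear map. -/
def mulSeries (x : LaurentSeries R) : LaurentSeries R →ₗ[R] LaurentSeries R where
  toFun f := x * f
  map_add' := mul_add x
  map_smul' r f := by
    simp only [RingHom.id_apply, ← HahnSeries.C_mul_eq_smul]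
    ring

end Truncation

/-! ### Heisenberg operators -/

section Heisenberg

variable {R : Type*} [CommRing R]

open Classical in
/-- The sum of a locally finite family of linear maps. -/
def locSum {ι : Type*} (T : ι → Module.End R (Fock R)) : Module.End R (Fock R) :=
  if h : ∀ v, (Function.support fun i => T i v).Finite then
    { toFun := fun v => ∑ᶠ i, T i v
      map_add' := fun v w => by
        simp only [map_add]
        exact finsum_add_distrib (h v) (h w)
      map_smul' := fun r v => by
        simp only [map_smul, RingHom.id_apply]
        exact (smul_finsum' r (h v)).symm }
  else 0

theorem locSum_apply {ι : Type*} {T : ι → Module.End R (Fock R)}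
    (h : ∀ v, (Function.support fun i => T i v).Finite) (v : Fock R) :
    locSum T v = ∑ᶠ i, T i v := by
  rw [locSum, dif_pos h]
  rfl

theorem exists_phi_eq_zero (v : Fock R) : ∃ N : ℕ, ∀ n : ℤ, n ≤ -N → phi n v = 0 := by
  obtain ⟨N, hN⟩ := exists_field_eq_zero v
  refine ⟨N, fun n hn => ?_⟩
  have h := hN (HahnSeries.single (-n) 1) ((vanishesBelow_single _ _).mono (by omega))
  rwa [field_single, one_smul, neg_neg] at h

/-- The summands of four times the Heisenberg generator `b_m`. -/
def heisTerm (m i : ℤ) : Module.End R (Fock R) :=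
  (-1 : R) ^ i.natAbs • (phi (-i - m) ∘ₗ phi i)

/-- Either φ_i already kills v, or φ_{-i-m} does and can be moved to the right: the two modes
anticommute because m ≠ 0. -/
theorem heisTerm_eq_zero {m : ℤ} (hm : m ≠ 0) {v : Fock R} {N : ℕ}
    (hN : ∀ n : ℤ, n ≤ -N → phi n v = 0) {i : ℤ} (hi : i ≤ -N ∨ N - m ≤ i) :
    heisTerm m i v = 0 := by
  have : phi (-i - m) (phi i v) = 0 := by
    rcases hi with hi | hi
    · rw [hN i hi, map_zero]
    · have h := phi_anticomm (-i - m) i v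
      rwa [hN (-i - m) (by omega), map_zero, add_zero, if_neg (by omega)] at h
  simp [heisTerm, this]

theorem heisTerm_finite {m : ℤ} (hm : m ≠ 0) (v : Fock R) :
    (Function.support fun i => heisTerm m i v).Finite := by
  obtain ⟨N, hN⟩ := exists_phi_eq_zero v
  refine (Set.finite_Ioo (-N : ℤ) (N - m)).subset fun i hi => ?_
  by_contra h
  rw [Set.mem_Ioo, not_and_or, not_lt, not_lt] at h
  exact hi (heisTerm_eq_zero hm hN h)

/-- This is [φ_a φ_i, φ_n] = φ_a {φ_i, φ_n} - {φ_a, φ_n} φ_i for a = -i - m; the two anticommutators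
are nonzero for one i each. -/
theorem heisTerm_phi (m n i : ℤ) (v : Fock R) :
    heisTerm m i (phi n v) - phi n (heisTerm m i v) =
      (if i = -n then (2 : R) • phi (n - m) v else 0) -
        if i = n - m then ((-1 : R) ^ m.natAbs * 2) • phi (n - m) v else 0 := by
  have h1 := phi_anticomm i n v
  have h2 := phi_anticomm (-i - m) n (phi i v)
  have h3 := congrArg (phi (-i - m)) h1
  rw [map_add] at h3
  have key : phi (-i - m) (phi i (phi n v)) - phi n (phi (-i - m) (phi i v)) =
      phi (-i - m) (if i + n = 0 then (2 * (-1 : R) ^ i.natAbs) • v else 0) -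
        if -i - m + n = 0 then (2 * (-1 : R) ^ (-i - m).natAbs) • phi i v else 0 := by
    rw [← h3, ← h2]; abel
  have sgn : ∀ a : ℤ, (-1 : R) ^ a.natAbs * (-1) ^ a.natAbs = 1 := fun a => by
    rw [← mul_pow]; simp
  simp only [heisTerm, LinearMap.smul_apply, LinearMap.comp_apply, map_smul]
  rw [← smul_sub, key, smul_sub]
  congr 1
  · by_cases h : i = -n
    · rw [if_pos (by omega), if_pos h, map_smul, smul_smul,
        show (-1 : R) ^ i.natAbs * (2 * (-1) ^ i.natAbs) = 2 by linear_combination 2 * sgn i,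
        show -i - m = n - m by omega]
    · rw [if_neg (by omega), if_neg h, map_zero, smul_zero]
  · by_cases h : i = n - m
    · rw [if_pos (by omega), if_pos h, smul_smul, h]
      congr 1
      rw [show -(n - m) - m = -n by ring, Int.natAbs_neg]
      have e : (-1 : R) ^ (n - m).natAbs * (-1) ^ n.natAbs = (-1) ^ m.natAbs := by
        have := congrArg (Int.cast (R := R))
          (show (-1 : ℤ) ^ (n - m).natAbs * (-1) ^ n.natAbs = (-1) ^ m.natAbs by
            rw [← pow_add]
            rcases Nat.even_or_odd m.natAbs with h | h
            · rw [h.neg_one_pow, Even.neg_one_pow]; grind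
            · rw [h.neg_one_pow, Odd.neg_one_pow]; grind)
        simpa using this
      linear_combination 2 * e
    · rw [if_neg (by omega), if_neg h, smul_zero]

variable [Algebra ℚ R]

/-- The Heisenberg generator `b_m`, `m ≠ 0`, as a linear map. -/
def heisLin (m : ℤ) : Module.End R (Fock R) :=
  algebraMap ℚ R (1 / 4) • locSum (heisTerm m)

theorem heis_eq_heisLin {m : ℤ} (hm : m ≠ 0) (v : Fock R) : heis m v = heisLin m v := by
  rw [heis, heisLin, LinearMap.smul_apply, locSum_apply (heisTerm_finite hm)]
  rfl

theorem exists_heisLin_eq_zero (v : Fock R) : ∃ N : ℕ, ∀ k : ℕ, N ≤ k → heisLin (k : ℤ) v = 0 := by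
  obtain ⟨N, hN⟩ := exists_phi_eq_zero v
  refine ⟨2 * N + 1, fun k hk => ?_⟩
  have hk' : (k : ℤ) ≠ 0 := by omega
  rw [heisLin, LinearMap.smul_apply, locSum_apply (heisTerm_finite hk'),
    finsum_eq_zero_of_forall_eq_zero, smul_zero]
  intro i
  exact heisTerm_eq_zero hk' hN (by omega)

theorem heisLin_vac {k : ℕ} (hk : k ≠ 0) : heisLin (k : ℤ) (vac R) = 0 := by
  have hk' : (k : ℤ) ≠ 0 := by omega
  rw [heisLin, LinearMap.smul_apply, locSum_apply (heisTerm_finite hk'),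
    finsum_eq_zero_of_forall_eq_zero, smul_zero]
  intro i
  -- With N = 1 the ranges i ≤ -1 and i ≥ 1 - k cover all integers, since k ≥ 1.
  exact heisTerm_eq_zero (N := 1) hk' (fun n hn => phi_neg_vac n (by simp at hn; omega)) (by simp; omega)

/-- The two surviving indices contribute 2 φ_{n-m} each, with equal signs because m is odd, and the
total 4 cancels the normalisation 1/4. -/
theorem heisLin_phi {m : ℤ} (hm : Odd m) (n : ℤ) (v : Fock R) :
    heisLin m (phi n v) = phi (n - m) v + phi n (heisLin m v) := by
  have hm0 : m ≠ 0 := by rintro rfl; simp at hm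
  have hodd : (-1 : R) ^ m.natAbs = -1 := Odd.neg_one_pow (Int.natAbs_odd.2 hm)
  rw [← sub_eq_iff_eq_add]
  simp only [heisLin, LinearMap.smul_apply, map_smul, locSum_apply (heisTerm_finite hm0)]
  have h1 : phi n (∑ᶠ i, heisTerm m i v) = ∑ᶠ i, phi n (heisTerm m i v) :=
    (phi n).toAddMonoidHom.map_finsum (heisTerm_finite hm0 v)
  have h2 : (Function.support fun i => phi n (heisTerm m i v)).Finite :=
    (heisTerm_finite hm0 v).subset fun i hi h => hi (by simp [h])
  rw [← smul_sub, h1, ← finsum_sub_distrib (heisTerm_finite hm0 _) h2]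
  simp only [heisTerm_phi]
  rw [finsum_sub_distrib, finsum_eq_single _ (-n), finsum_eq_single _ (n - m), if_pos rfl,
    if_pos rfl, hodd, ← sub_smul, smul_smul]
  · have : algebraMap ℚ R (1 / 4) * (2 - -1 * 2) = 1 := by
      rw [show (2 - -1 * 2 : R) = algebraMap ℚ R 4 by rw [map_ofNat]; norm_num, ← map_mul]
      norm_num
    rw [this, one_smul]
  · intro i hi; rw [if_neg hi]
  · intro i hi; rw [if_neg hi]
  · exact (Set.finite_singleton (-n)).subset fun i hi => by
      by_contra h; exact hi (if_neg h)
  · exact (Set.finite_singleton (n - m)).subset fun i hi => by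
      by_contra h; exact hi (if_neg h)

/-- Both sides are linear in f and vanish for f of large order, so monomials suffice, where this is
`heisLin_phi`. -/
theorem heisLin_field {m : ℤ} (hm : Odd m) (f : LaurentSeries R) (v : Fock R) :
    heisLin m (field f v) = field (HahnSeries.single m 1 * f) v + field f (heisLin m v) := by
  refine eq_of_eq_on_single (A := heisLin m ∘ₗ field.flip v)
    (B := field.flip v ∘ₗ mulSeries (HahnSeries.single m 1) + field.flip (heisLin m v))
    ?_ ?_ ?_ f
  · intro n
    simp only [LinearMap.comp_apply, LinearMap.flip_apply, LinearMap.add_apply,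
      mulSeries, LinearMap.coe_mk, AddHom.coe_mk, HahnSeries.single_mul_single, mul_one, field_single, one_smul]
    rw [heisLin_phi hm, show -n - m = -(m + n) by ring]
  · obtain ⟨N, hN⟩ := exists_field_eq_zero' v
    exact ⟨N, fun f hf => by simp [hN f hf]⟩
  · obtain ⟨N, hN⟩ := exists_field_eq_zero' v
    obtain ⟨M, hM⟩ := exists_field_eq_zero' (heisLin m v)
    refine ⟨max (N - m) M, fun f hf => ?_⟩
    have h1 := hN _ (((vanishesBelow_single m (1 : R)).mul
      (hf.mono (le_max_left _ _))).mono (by omega))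
    simp [mulSeries, hM f (hf.mono (le_max_right _ _)), h1]

end Heisenberg

/-! ### Exponentials of Heisenberg operators -/

section Exponential

variable {R : Type*} [CommRing R]

/-- A power series with only odd terms. -/
def OddSeries (h : PowerSeries R) : Prop := ∀ k, Even k → PowerSeries.coeff k h = 0

theorem OddSeries.constantCoeff {h : PowerSeries R} (hh : OddSeries h) :
    PowerSeries.constantCoeff h = 0 := by
  simpa using hh 0 Even.zero

variable [Algebra ℚ R]

/-- The operator `∑_k h_k b_k`. -/
def heisSum (h : PowerSeries R) : Module.End R (Fock R) :=
  locSum fun k : ℕ => PowerSeries.coeff k h • heisLin (k : ℤ)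

theorem heisSum_finite (h : PowerSeries R) (v : Fock R) :
    (Function.support fun k : ℕ => (PowerSeries.coeff k h • heisLin (k : ℤ) :
      Module.End R (Fock R)) v).Finite := by
  obtain ⟨N, hN⟩ := exists_heisLin_eq_zero v
  refine (Set.finite_Iio N).subset fun k hk => ?_
  by_contra h'
  exact hk (by simp [hN k (not_lt.1 h')])

theorem heisSum_eq_sum_range (h : PowerSeries R) {v : Fock R} {N : ℕ}
    (hN : ∀ k : ℕ, N ≤ k → heisLin (k : ℤ) v = 0) :
    heisSum h v = ∑ k ∈ Finset.range N, PowerSeries.coeff k h • heisLin (k : ℤ) v := by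
  rw [heisSum, locSum_apply (heisSum_finite h)]
  refine finsum_eq_sum_of_support_subset _ fun k hk => ?_
  by_contra h'
  exact hk (by simp [hN k (by simpa using h')])

theorem heisSum_vac {h : PowerSeries R} (hh : OddSeries h) : heisSum h (vac R) = 0 := by
  rw [heisSum, locSum_apply (heisSum_finite h), finsum_eq_zero_of_forall_eq_zero]
  intro k
  rcases eq_or_ne k 0 with rfl | hk
  · simp [hh 0 Even.zero]
  · simp [heisLin_vac hk]

/-- The image of a power series in the Laurent series. -/
abbrev lau (f : PowerSeries R) : LaurentSeries R := HahnSeries.ofPowerSeries ℤ R f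

theorem heisSum_field {h : PowerSeries R} (hh : OddSeries h) (f : LaurentSeries R) (v : Fock R) :
    heisSum h (field f v) = field (lau h * f) v + field f (heisSum h v) := by
  obtain ⟨N₁, h₁⟩ := exists_heisLin_eq_zero v
  obtain ⟨N₂, h₂⟩ := exists_heisLin_eq_zero (field f v)
  obtain ⟨N₃, h₃⟩ := exists_field_eq_zero v
  obtain ⟨L, hL⟩ := exists_vanishesBelow f
  -- Beyond M the modes b_k kill v and Φ(f)v, and the tail of h times f has order large enough to
  -- kill v.
  set M := max (max N₁ N₂) (N₃ + L.natAbs) with hM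
  obtain ⟨g, hg⟩ := subst_eq_sum_add (a := (PowerSeries.X : PowerSeries R)) (by simp) h M
  rw [PowerSeries.X_subst] at hg
  rw [heisSum_eq_sum_range (N := M) h fun k hk => h₂ k (by omega),
    heisSum_eq_sum_range (N := M) h fun k hk => h₁ k (by omega)]
  have hz : field (lau (PowerSeries.X ^ M * g) * f) v = 0 := by
    refine h₃ _ (VanishesBelow.mono (L := (M : ℤ) + 0 + L) ?_ (by omega))
    rw [lau, map_mul, map_pow]
    exact (((vanishesBelow_one_of_constantCoeff (by simp)).pow M).mul
      (vanishesBelow_ofPowerSeries g)).mul hL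
  have hsum : lau h * f = ∑ k ∈ Finset.range M, PowerSeries.coeff k h •
      (HahnSeries.single (k : ℤ) (1 : R) * f) + lau (PowerSeries.X ^ M * g) * f := by
    conv_lhs => rw [hg]
    rw [lau, map_add, add_mul, map_sum, Finset.sum_mul]
    congr 1
    refine Finset.sum_congr rfl fun k _ => ?_
    rw [map_mul, HahnSeries.ofPowerSeries_C, HahnSeries.ofPowerSeries_X_pow, mul_assoc,
      HahnSeries.C_mul_eq_smul]
  rw [hsum, map_add, LinearMap.add_apply, hz, add_zero, map_sum, map_sum, LinearMap.sum_apply,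
    ← Finset.sum_add_distrib]
  refine Finset.sum_congr rfl fun k _ => ?_
  rcases Nat.even_or_odd k with hk | hk
  · simp [hh k hk]
  · rw [heisLin_field (by exact_mod_cast hk)]
    simp

/-- Leibniz formula for a derivation-like pair of operators on fields. -/
theorem heisSum_pow_field {h : PowerSeries R} (hh : OddSeries h) (f : LaurentSeries R)
    (v : Fock R) (n : ℕ) :
    (heisSum h ^ n) (field f v) = ∑ ij ∈ Finset.HasAntidiagonal.antidiagonal n,
      n.choose ij.1 • field (lau h ^ ij.1 * f) ((heisSum h ^ ij.2) v) := by
  induction n with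
  | zero => simp
  | succ n ih =>
    rw [Finset.sum_antidiagonal_choose_succ_nsmul
      (fun i j => field (lau h ^ i * f) ((heisSum h ^ j) v)) n, pow_succ', Module.End.mul_apply,
      ih, map_sum, ← Finset.sum_add_distrib]
    refine Finset.sum_congr rfl fun ij hij => ?_
    rw [Finset.HasAntidiagonal.mem_antidiagonal] at hij
    rw [map_nsmul, heisSum_field hh, nsmul_add, add_comm, pow_succ' (heisSum h),
      Module.End.mul_apply, pow_succ' (lau h), mul_assoc,
      Nat.choose_symm_of_eq_add (n := n) (a := ij.1) (b := ij.2) hij.symm]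

theorem expOp_eq_sum_range {D : Module.End R (Fock R)} {v : Fock R} {M : ℕ}
    (hM : (D ^ M) v = 0) :
    expOp D v = ∑ m ∈ Finset.range M, algebraMap ℚ R (1 / (m.factorial : ℚ)) • (D ^ m) v := by
  rw [expOp]
  simp only [← Module.End.pow_apply]
  refine finsum_eq_sum_of_support_subset _ fun k hk => ?_
  by_contra h'
  refine hk ?_
  obtain ⟨j, rfl⟩ := Nat.exists_eq_add_of_le (show M ≤ k by simpa using h')
  dsimp only
  rw [add_comm, pow_add, Module.End.mul_apply, hM, map_zero, smul_zero]

/-- The triangle i + j < 2M contains the square i, j < M, outside of which g vanishes. -/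
theorem sum_range_antidiagonal_eq {A : Type*} [AddCommMonoid A] (g : ℕ → ℕ → A) (M : ℕ)
    (hg : ∀ i j, M ≤ i ∨ M ≤ j → g i j = 0) :
    ∑ n ∈ Finset.range (2 * M), ∑ ij ∈ Finset.HasAntidiagonal.antidiagonal n, g ij.1 ij.2 =
      ∑ j ∈ Finset.range M, ∑ i ∈ Finset.range M, g i j := by
  have e : ∑ j ∈ Finset.range M, ∑ i ∈ Finset.range M, g i j =
      ∑ p ∈ Finset.range M ×ˢ Finset.range M, g p.1 p.2 := by
    rw [Finset.sum_comm, Finset.sum_product]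
  rw [e, ← Finset.sum_fiberwise_of_maps_to (s := Finset.range M ×ˢ Finset.range M)
    (t := Finset.range (2 * M)) (g := fun p => p.1 + p.2)]
  · refine Finset.sum_congr rfl fun n _ => ?_
    symm
    refine Finset.sum_subset (fun p hp => ?_) fun p hp hp' => ?_
    · rw [Finset.mem_filter] at hp
      exact Finset.HasAntidiagonal.mem_antidiagonal.2 hp.2
    · rw [Finset.HasAntidiagonal.mem_antidiagonal] at hp
      refine hg _ _ ?_
      by_contra h
      rw [not_or, not_le, not_le] at h
      exact hp' (Finset.mem_filter.2 ⟨Finset.mem_product.2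
        ⟨Finset.mem_range.2 h.1, Finset.mem_range.2 h.2⟩, hp⟩)
  · intro p hp
    rw [Finset.mem_product, Finset.mem_range, Finset.mem_range] at hp
    rw [Finset.mem_range]
    omega

/-- The exponential of a power series. -/
def expSeries (h : PowerSeries R) : PowerSeries R := (PowerSeries.exp R).subst h

/-- The operator `D` is nilpotent on the vector `v`. -/
def NilpotentAt (D : Module.End R (Fock R)) (v : Fock R) : Prop := ∃ a : ℕ, (D ^ a) v = 0

/-- The Leibniz formula divided by n! is the Cauchy product of e^h and the exponential of the
operator. Nilpotency is proved alongside because it is what makes the next exponential a finite sum.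
-/
theorem heisSum_nilpotentAt_and_expOp_field {h : PowerSeries R} (hh : OddSeries h)
    (f : LaurentSeries R) {v : Fock R} (hv : NilpotentAt (heisSum h) v) :
    NilpotentAt (heisSum h) (field f v) ∧
      expOp (heisSum h) (field f v) =
        field (lau (expSeries h) * f) (expOp (heisSum h) v) := by
  obtain ⟨a, ha⟩ := hv
  obtain ⟨L, hL⟩ := exists_vanishesBelow f
  choose N hN using fun j : ℕ => exists_field_eq_zero ((heisSum h ^ j) v)
  -- For j ≥ M the power kills v; for i ≥ M the order of h^i f, at least i + L, exceeds every
  -- threshold of the finitely many nonzero vectors D^j v.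
  set M := max a ((Finset.range a).sup N + L.natAbs) with hM
  have hj : ∀ j, M ≤ j → (heisSum h ^ j) v = 0 := by
    intro j hj
    obtain ⟨i, rfl⟩ := Nat.exists_eq_add_of_le (show a ≤ j by omega)
    rw [add_comm, pow_add, Module.End.mul_apply, ha, map_zero]
  have hlow : ∀ j (g : LaurentSeries R), VanishesBelow (M + L) g →
      field g ((heisSum h ^ j) v) = 0 := by
    intro j g hg
    rcases lt_or_ge j a with h' | h'
    · have := Finset.le_sup (f := N) (Finset.mem_range.2 h')
      exact hN j _ (hg.mono (by omega))
    · obtain ⟨i, rfl⟩ := Nat.exists_eq_add_of_le h'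
      rw [add_comm, pow_add, Module.End.mul_apply, ha, map_zero, map_zero]
  have hpow : ∀ i : ℕ, VanishesBelow i (lau h ^ i) := fun i =>
    (vanishesBelow_one_of_constantCoeff hh.constantCoeff).pow i
  have hz : ∀ i j, M ≤ i ∨ M ≤ j → field (lau h ^ i * f) ((heisSum h ^ j) v) = 0 := by
    rintro i j (h' | h')
    · exact hlow j _ (((hpow i).mul hL).mono (by omega))
    · rw [hj j h', map_zero]
  have hnil : (heisSum h ^ (2 * M)) (field f v) = 0 := by
    rw [heisSum_pow_field hh]
    refine Finset.sum_eq_zero fun ij hij => ?_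
    rw [Finset.HasAntidiagonal.mem_antidiagonal] at hij
    rw [hz _ _ (by omega), smul_zero]
  refine ⟨⟨_, hnil⟩, ?_⟩
  rw [expOp_eq_sum_range hnil, expOp_eq_sum_range (hj M le_rfl), map_sum]
  have h1 : ∀ n, algebraMap ℚ R (1 / (n.factorial : ℚ)) • (heisSum h ^ n) (field f v) =
      ∑ ij ∈ Finset.HasAntidiagonal.antidiagonal n, (algebraMap ℚ R (1 / (ij.1.factorial : ℚ)) *
        algebraMap ℚ R (1 / (ij.2.factorial : ℚ))) •
          field (lau h ^ ij.1 * f) ((heisSum h ^ ij.2) v) := by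
    intro n
    rw [heisSum_pow_field hh, Finset.smul_sum]
    refine Finset.sum_congr rfl fun ij hij => ?_
    rw [Finset.HasAntidiagonal.mem_antidiagonal] at hij
    rw [← Nat.cast_smul_eq_nsmul R, smul_smul]
    congr 1
    rw [← map_natCast (algebraMap ℚ R), ← map_mul, ← map_mul]
    congr 1
    subst hij
    have h2 := Nat.add_choose_mul_factorial_mul_factorial ij.1 ij.2
    have h3 : ((ij.1 + ij.2).choose ij.2 : ℚ) * ij.1.factorial * ij.2.factorial =
        (ij.1 + ij.2).factorial := by exact_mod_cast h2
    rw [Nat.choose_symm_add.symm] at h3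
    have e1 : (ij.1.factorial : ℚ) ≠ 0 := by positivity
    have e2 : (ij.2.factorial : ℚ) ≠ 0 := by positivity
    have e3 : ((ij.1 + ij.2).factorial : ℚ) ≠ 0 := by positivity
    field_simp
    linear_combination h3
  simp only [h1]
  rw [sum_range_antidiagonal_eq (fun i j => (algebraMap ℚ R (1 / (i.factorial : ℚ)) *
        algebraMap ℚ R (1 / (j.factorial : ℚ))) •
          field (lau h ^ i * f) ((heisSum h ^ j) v)) M
        fun i j hij => by rw [hz i j hij, smul_zero]]
  refine Finset.sum_congr rfl fun j _ => ?_
  obtain ⟨g, hg⟩ := subst_eq_sum_add hh.constantCoeff (PowerSeries.exp R) M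
  have hr : field (lau (h ^ M * g) * f) ((heisSum h ^ j) v) = 0 := by
    refine hlow j _ (VanishesBelow.mono (L := (M : ℤ) + 0 + L) ?_ (by omega))
    rw [lau, map_mul, map_pow]
    exact ((hpow M).mul (vanishesBelow_ofPowerSeries g)).mul hL
  have he : lau (expSeries h) * f = ∑ i ∈ Finset.range M,
      algebraMap ℚ R (1 / (i.factorial : ℚ)) • (lau h ^ i * f) + lau (h ^ M * g) * f := by
    rw [expSeries, hg, lau, map_add, add_mul, map_sum, Finset.sum_mul]
    congr 1
    refine Finset.sum_congr rfl fun k _ => ?_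
    rw [map_mul, HahnSeries.ofPowerSeries_C, mul_assoc, HahnSeries.C_mul_eq_smul, map_pow,
      PowerSeries.coeff_exp]
  rw [map_smul, he, map_add, LinearMap.add_apply, hr, add_zero, map_sum, LinearMap.sum_apply,
    Finset.smul_sum]
  refine Finset.sum_congr rfl fun i _ => ?_
  rw [map_smul, LinearMap.smul_apply, smul_smul, mul_comm]

theorem expOp_heisSum_word {h : PowerSeries R} (hh : OddSeries h) (n : ℕ)
    (f : Fin n → LaurentSeries R) :
    NilpotentAt (heisSum h) (word n f) ∧
      expOp (heisSum h) (word n f) = word n fun i => lau (expSeries h) * f i := by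
  induction n with
  | zero =>
    have h1 : (heisSum h ^ 1) (vac R) = 0 := by rw [pow_one, heisSum_vac hh]
    refine ⟨⟨1, h1⟩, ?_⟩
    rw [word, expOp_eq_sum_range h1]
    simp [word]
  | succ n ih =>
    obtain ⟨h1, h2⟩ := heisSum_nilpotentAt_and_expOp_field hh (f 0) (ih fun i => f i.succ).1
    exact ⟨h1, by rw [word, h2, (ih fun i => f i.succ).2]; rfl⟩

end Exponential

/-! ### Exponentials and logarithms of power series -/

section ExpSeries

variable {R : Type*} [CommRing R]

open PowerSeries in
theorem coeff_subst_eq_sum_range {a : PowerSeries R} (ha : constantCoeff a = 0)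
    (f : PowerSeries R) {k N : ℕ} (hk : k < N) :
    coeff k (f.subst a) = ∑ n ∈ Finset.range N, coeff n f * coeff k (a ^ n) := by
  rw [coeff_subst' (HasSubst.of_constantCoeff_zero' ha),
    finsum_eq_sum_of_support_subset (s := Finset.range N)]
  · rfl
  · intro n hn
    by_contra h
    refine hn ?_
    have : coeff k (a ^ n) = 0 := by
      refine coeff_of_lt_order _ (lt_of_lt_of_le ?_ (le_order_pow_of_constantCoeff_eq_zero n ha))
      have : N ≤ n := by simpa using h
      exact_mod_cast hk.trans_le this
    simp [this]

theorem geom_mul_one_sub (c : R) : geom c * (1 - PowerSeries.C c * PowerSeries.X) = 1 :=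
  geom_mul c

theorem constantCoeff_geom (c : R) : PowerSeries.constantCoeff (geom c) = 1 := by
  simp [geom, ← PowerSeries.coeff_zero_eq_constantCoeff_apply]

theorem map_geom {S : Type*} [CommRing S] (φ : R →+* S) (c : R) :
    PowerSeries.map φ (geom c) = geom (φ c) := by
  ext n
  simp [geom]

theorem rescale_geom (a c : R) : PowerSeries.rescale a (geom c) = geom (a * c) := by
  ext n
  simp [geom, mul_pow]

open PowerSeries

theorem constantCoeff_subst_zero {a : PowerSeries R} (ha : constantCoeff a = 0)
    {f : PowerSeries R} (hf : constantCoeff f = 0) : constantCoeff (f.subst a) = 0 := by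
  obtain ⟨g, hg⟩ := subst_eq_sum_add ha f 1
  rw [hg]
  simp [hf, ha]

variable [Algebra ℚ R]

theorem constantCoeff_expSeries {h : PowerSeries R} (hh : constantCoeff h = 0) :
    constantCoeff (expSeries h) = 1 := by
  obtain ⟨g, hg⟩ := subst_eq_sum_add hh (PowerSeries.exp R) 1
  rw [expSeries, hg]
  simp [hh]

theorem derivative_expSeries {h : PowerSeries R} (hh : constantCoeff h = 0) :
    derivative R (expSeries h) = expSeries h * derivative R h := by
  rw [expSeries, derivative_subst (HasSubst.of_constantCoeff_zero' hh), derivative_exp]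

theorem eq_one_of_derivative_eq_zero {f : PowerSeries R} (h : derivative R f = 0)
    (h1 : constantCoeff f = 1) : f = 1 := by
  have := IsAddTorsionFree.of_module_rat R
  exact derivative.ext (by rw [h, derivative_one]) (by simp [h1])

/-- Uniqueness for E' = E h', E(0) = 1: any solution times exp(-h) has derivative 0, hence is
constant over a ℚ-algebra. The other exponential identities are derived from it. -/
theorem eq_expSeries {E h : PowerSeries R} (hh : constantCoeff h = 0)
    (hE : derivative R E = E * derivative R h) (h1 : constantCoeff E = 1) : E = expSeries h := by
  have hh' : constantCoeff (-h) = 0 := by simp [hh]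
  have key : ∀ F : PowerSeries R, derivative R F = F * derivative R h → constantCoeff F = 1 →
      F * expSeries (-h) = 1 := by
    intro F hF h1
    refine eq_one_of_derivative_eq_zero ?_ (by simp [h1, constantCoeff_expSeries hh'])
    rw [Derivation.leibniz, derivative_expSeries hh', hF, map_neg, smul_eq_mul, smul_eq_mul]
    ring
  have e1 := key E hE h1
  have e2 := key (expSeries h) (derivative_expSeries hh) (constantCoeff_expSeries hh)
  linear_combination expSeries h * e1 - E * e2

theorem expSeries_add {h h' : PowerSeries R} (hh : constantCoeff h = 0)
    (hh' : constantCoeff h' = 0) : expSeries (h + h') = expSeries h * expSeries h' := by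
  symm
  refine eq_expSeries (by simp [hh, hh']) ?_
    (by simp [constantCoeff_expSeries hh, constantCoeff_expSeries hh'])
  rw [Derivation.leibniz, derivative_expSeries hh, derivative_expSeries hh', map_add,
    smul_eq_mul, smul_eq_mul]
  ring

theorem expSeries_zero : expSeries (0 : PowerSeries R) = 1 :=
  (eq_expSeries (by simp) (by simp) (by simp)).symm

theorem expSeries_sum {ι : Type*} (s : Finset ι) (h : ι → PowerSeries R)
    (hh : ∀ i ∈ s, constantCoeff (h i) = 0) :
    expSeries (∑ i ∈ s, h i) = ∏ i ∈ s, expSeries (h i) := by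
  classical
  induction s using Finset.induction_on with
  | empty => simp [expSeries_zero]
  | insert a s ha ih =>
    rw [Finset.sum_insert ha, Finset.prod_insert ha, expSeries_add (hh a (by simp)),
      ih fun i hi => hh i (by simp [hi])]
    rw [map_sum]
    exact Finset.sum_eq_zero fun i hi => hh i (by simp [hi])

theorem expSeries_subst {a h : PowerSeries R} (ha : constantCoeff a = 0)
    (hh : constantCoeff h = 0) : expSeries (h.subst a) = (expSeries h).subst a := by
  rw [expSeries, expSeries, subst_comp_subst_apply (HasSubst.of_constantCoeff_zero' hh)
    (HasSubst.of_constantCoeff_zero' ha)]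

theorem map_expSeries {S : Type*} [CommRing S] [Algebra ℚ S] (φ : R →+* S) {h : PowerSeries R}
    (hh : constantCoeff h = 0) : PowerSeries.map φ (expSeries h) = expSeries (map φ h) := by
  refine (map_subst (h := φ) (HasSubst.of_constantCoeff_zero' hh) (exp R)).trans ?_
  rw [map_exp]
  rfl

/-- The series `-log (1 - X) = ∑ X^n / n`. -/
def logSeries (R : Type*) [CommRing R] [Algebra ℚ R] : PowerSeries R :=
  mk fun n => algebraMap ℚ R (1 / n)

/-- Uses the convention 1/0 = 0 in ℚ. -/
theorem constantCoeff_logSeries : constantCoeff (logSeries R) = 0 := by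
  simp [logSeries, ← coeff_zero_eq_constantCoeff_apply]

theorem derivative_logSeries : derivative R (logSeries R) * (1 - X) = 1 := by
  have h : derivative R (logSeries R) = geom 1 := by
    ext n
    rw [coeff_derivative, logSeries, geom, coeff_mk, coeff_mk, one_pow]
    rw [show (n + 1 : R) = algebraMap ℚ R (n + 1) by simp, ← map_mul]
    rw [← map_one (algebraMap ℚ R)]
    congr 1
    push_cast
    field_simp
  rw [h]
  simpa using geom_mul_one_sub (1 : R)

theorem expSeries_neg_log {a : PowerSeries R} (ha : constantCoeff a = 0) :
    expSeries (-(logSeries R).subst a) = 1 - a := by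
  symm
  have hs := HasSubst.of_constantCoeff_zero' ha
  refine eq_expSeries (by simp [constantCoeff_subst_zero ha constantCoeff_logSeries]) ?_
    (by simp [ha])
  have h := congrArg (PowerSeries.subst a) (derivative_logSeries (R := R))
  rw [subst_mul hs, subst_sub hs, subst_X hs, ← coe_substAlgHom hs, map_one] at h
  rw [map_neg, derivative_subst hs, ← coe_substAlgHom hs, map_sub, derivative_one]
  linear_combination (derivative R a) * h

theorem expSeries_log_mul {a : PowerSeries R} (ha : constantCoeff a = 0) :
    expSeries ((logSeries R).subst a) * (1 - a) = 1 := by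
  have h0 := constantCoeff_subst_zero ha (constantCoeff_logSeries (R := R))
  rw [← expSeries_neg_log ha, ← expSeries_add h0 (by simp [h0]), add_neg_cancel, expSeries_zero]

end ExpSeries

/-! ### The operators `θ`, `H^{[β]}` and `φ^{[β]}_n` as Heisenberg sums and fields -/

section Identification

variable {R : Type*} [CommRing R]

open PowerSeries

/-- The series `y ↦ z = y / (1 - c y)`. -/
def zSub (c : R) : PowerSeries R := X * geom c

/-- The series `y ↦ z̄ = -y / (1 + c y)`. -/
def zbarSub (c : R) : PowerSeries R := -(X * geom (-c))

theorem constantCoeff_zSub (c : R) : constantCoeff (zSub c) = 0 := by simp [zSub]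

theorem constantCoeff_zbarSub (c : R) : constantCoeff (zbarSub c) = 0 := by simp [zbarSub]

/-- The sign change t ↦ -t exchanges z and z̄; this is why only odd Heisenberg modes occur in
H^{[β]}. -/
theorem rescale_zSub (c : R) : rescale (-1) (zSub c) = zbarSub c := by
  rw [zSub, zbarSub, map_mul, rescale_geom, rescale_X]
  simp

theorem coeff_zbarSub_pow (c : R) (n k : ℕ) :
    coeff k (zbarSub c ^ n) = (-1) ^ k * coeff k (zSub c ^ n) := by
  rw [← rescale_zSub, ← map_pow, coeff_rescale]

/-- The unit `z⁻¹ = t⁻¹ (1 - c t)` of the Laurent series. -/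
def zInv (c : R) : (LaurentSeries R)ˣ where
  val := HahnSeries.single (-1) 1 * lau (1 - C c * X)
  inv := lau (zSub c)
  val_inv := by
    rw [zSub, lau, lau, map_mul, HahnSeries.ofPowerSeries_X]
    have h := congrArg (HahnSeries.ofPowerSeries ℤ R) (geom_mul_one_sub c)
    rw [map_mul, map_one] at h
    have h1 : (HahnSeries.single (-1) 1 * HahnSeries.single 1 1 : LaurentSeries R) = 1 := by
      rw [HahnSeries.single_mul_single]; simp
    linear_combination h1 * (HahnSeries.ofPowerSeries ℤ R (geom c) *
      HahnSeries.ofPowerSeries ℤ R (1 - C c * X)) + h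
  inv_val := by
    rw [zSub, lau, lau, map_mul, HahnSeries.ofPowerSeries_X]
    have h := congrArg (HahnSeries.ofPowerSeries ℤ R) (geom_mul_one_sub c)
    rw [map_mul, map_one] at h
    have h1 : (HahnSeries.single (-1) 1 * HahnSeries.single 1 1 : LaurentSeries R) = 1 := by
      rw [HahnSeries.single_mul_single]; simp
    linear_combination h1 * (HahnSeries.ofPowerSeries ℤ R (geom c) *
      HahnSeries.ofPowerSeries ℤ R (1 - C c * X)) + h

/-- The coefficient series of the deformed fermion `φ^{[β]}_n`. -/
def modeSeries (c : R) (n : ℤ) : LaurentSeries R :=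
  ((zInv c ^ n : (LaurentSeries R)ˣ) : LaurentSeries R) * lau (geom c)

theorem lau_zSub_mul_modeSeries (c : R) (n : ℤ) :
    lau (zSub c) * modeSeries c n = modeSeries c (n - 1) := by
  rw [modeSeries, modeSeries, zpow_sub_one, Units.val_mul, mul_comm (_ : LaurentSeries R),
    mul_comm _ (lau (zSub c)), mul_assoc, mul_comm _ (lau (geom c)), ← mul_assoc, mul_comm]
  congr 1

theorem single_neg_one_pow (n : ℕ) :
    (HahnSeries.single (-1) 1 : LaurentSeries R) ^ n = HahnSeries.single (-n : ℤ) 1 := by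
  rw [HahnSeries.single_pow]
  simp

/-- The factor 1/(1 - ct) cancels one of the n + 1 factors 1 - ct, leaving a Laurent polynomial with
exponents from -(n + 1) to -1. -/
theorem modeSeries_succ (c : R) (n : ℕ) :
    modeSeries c (n + 1 : ℕ) =
      HahnSeries.single (-(n + 1 : ℕ) : ℤ) 1 * lau ((1 - C c * X) ^ n) := by
  have h := congrArg (HahnSeries.ofPowerSeries ℤ R) (geom_mul_one_sub c)
  rw [map_mul, map_one] at h
  rw [modeSeries, zpow_natCast, Units.val_pow_eq_pow_val, zInv, mul_pow, single_neg_one_pow,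
    pow_succ (lau _), lau, lau, lau, map_pow]
  linear_combination (HahnSeries.single (-(n + 1 : ℕ) : ℤ) 1 *
    HahnSeries.ofPowerSeries ℤ R (1 - C c * X) ^ n) * h

theorem modeSeries_zero (c : R) : modeSeries c 0 = lau (geom c) := by
  simp [modeSeries]

theorem vanishesBelow_modeSeries (c : R) (n : ℤ) : VanishesBelow (-n) (modeSeries c n) := by
  rcases le_or_gt n 0 with h | h
  · obtain ⟨k, rfl⟩ : ∃ k : ℕ, n = -(k : ℤ) := ⟨n.natAbs, by omega⟩
    have e : ((zInv c ^ (-(k : ℤ)) : (LaurentSeries R)ˣ) : LaurentSeries R) = lau (zSub c) ^ k := by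
      rw [zpow_neg, zpow_natCast, ← inv_pow, Units.val_pow_eq_pow_val]
      rfl
    rw [modeSeries, e]
    have := ((vanishesBelow_one_of_constantCoeff (constantCoeff_zSub c)).pow k).mul
      (vanishesBelow_ofPowerSeries (geom c))
    exact this.mono (by omega)
  · obtain ⟨k, rfl⟩ : ∃ k : ℕ, n = (k + 1 : ℕ) := ⟨n.toNat - 1, by omega⟩
    rw [modeSeries_succ]
    exact ((vanishesBelow_single _ _).mul (vanishesBelow_ofPowerSeries _)).mono (by omega)

theorem coeff_one_sub_pow (c : R) (n j : ℕ) :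
    coeff j ((1 - C c * X) ^ n) = (-c) ^ j * (n.choose j : R) := by
  have h : (1 - C c * X : PowerSeries R) = rescale (-c) (((1 + Polynomial.X : Polynomial R)) : PowerSeries R) := by
    rw [Polynomial.coe_add, Polynomial.coe_one, Polynomial.coe_X, map_add, map_one, rescale_X]
    simp [sub_eq_add_neg]
  rw [h, ← map_pow, ← Polynomial.coe_pow, coeff_rescale, Polynomial.coeff_coe,
    Polynomial.coeff_one_add_X_pow]

theorem coeff_geom_pow (c : R) (d j : ℕ) :
    coeff j (geom c ^ (d + 1)) = c ^ j * ((d + j).choose d : R) := by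
  have h : geom c = rescale c (mk 1) := by
    ext n; simp [geom]
  rw [h, ← map_pow, coeff_rescale, mk_one_pow_eq_mk_choose_add, coeff_mk]

variable [Algebra ℚ R]

/-- The element `β / 2`. -/
abbrev half (β : R) : R := algebraMap ℚ R (1 / 2) * β

theorem half_add_half (β : R) : half β + half β = β := by
  rw [half, ← add_mul, ← map_add]
  norm_num

theorem half_neg (β : R) : algebraMap ℚ R (1 / 2) * -β = -half β := by
  rw [half]; ring

theorem coeff_modeSeries_zero (β : R) (m : ℤ) :
    (modeSeries (half β) 0).coeff m =
      (-1 : R) ^ (0 : ℤ).natAbs * phiBetaCoeff (-β) (-0) m * (-1 : R) ^ m.natAbs := by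
  rw [modeSeries_zero, coeff_coe, phiBetaCoeff]
  rcases lt_or_ge m 0 with h | h
  · rw [if_pos h, if_neg (by omega), if_neg (by omega)]
    simp
  · rw [if_neg (by omega), if_pos (by omega), half_neg]
    have e : m.toNat = m.natAbs := by omega
    rw [e]
    simp only [neg_zero, Int.toNat_zero, coeff_zero_eq_constantCoeff, map_pow, map_add,
      constantCoeff_X, constantCoeff_C, zero_add, Int.natAbs_zero, pow_zero, one_mul]
    rw [← mul_pow, geom, coeff_mk]
    ring

theorem coeff_modeSeries_succ (β : R) (n : ℕ) (m : ℤ) :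
    (modeSeries (half β) (n + 1 : ℕ)).coeff m =
      (-1 : R) ^ ((n + 1 : ℕ) : ℤ).natAbs * phiBetaCoeff (-β) (-((n + 1 : ℕ) : ℤ)) m *
        (-1 : R) ^ m.natAbs := by
  rw [modeSeries_succ, HahnSeries.coeff_single_mul, one_mul, coeff_coe, phiBetaCoeff,
    if_neg (show ¬(0 ≤ -((n + 1 : ℕ) : ℤ) ∧ 0 ≤ m) by omega), half_neg, neg_neg]
  rcases lt_or_ge m 0 with h | h
  · rw [if_pos (show -((n + 1 : ℕ) : ℤ) < 0 ∧ m < 0 by omega), mul_pow, coeff_X_pow_mul']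
    obtain ⟨M, rfl⟩ : ∃ M : ℕ, m = -((M + 1 : ℕ) : ℤ) := ⟨m.natAbs - 1, by omega⟩
    have e1 : (-((M + 1 : ℕ) : ℤ)).natAbs = M + 1 := by omega
    have e2 : (-((n + 1 : ℕ) : ℤ)).natAbs = n + 1 := by omega
    have e3 : (((n + 1 : ℕ) : ℤ)).natAbs = n + 1 := by omega
    rw [e1, e2, e3]
    by_cases hle : M ≤ n
    -- With n = M + j, both sides are c^j times the binomial coefficient of M + j over M, up to
    -- sign: one from (1 - ct)^n, the other from (1 - cX)^{-(M+1)}.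
    · obtain ⟨j, rfl⟩ := Nat.exists_eq_add_of_le hle
      rw [if_neg (by omega), if_pos (by omega),
        show (-((M + 1 : ℕ) : ℤ) - -((M + j + 1 : ℕ) : ℤ)).natAbs = j by omega,
        show M + j + 1 - (M + 1) = j by omega, coeff_one_sub_pow, coeff_geom_pow,
        Nat.choose_symm_add, neg_pow]
      have : (-1 : R) ^ (M + j + 1) * (-1) ^ (M + 1) = (-1) ^ j := by
        rw [← pow_add, show M + j + 1 + (M + 1) = 2 * (M + 1) + j by ring, pow_add, pow_mul]
        simp
      linear_combination (-(half β ^ j * ((M + j).choose j : R))) * this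
    · rw [if_pos (by omega), if_neg (by omega)]
      simp
  · rw [if_neg (by omega), if_neg (by omega), coeff_one_sub_pow, Nat.choose_eq_zero_of_lt]
    · simp
    · omega

theorem dphi_eq_field (β : R) (n : ℕ) (v : Fock R) :
    dphi β (n : ℤ) v = field (modeSeries (half β) n) v := by
  rw [← finsum_phi_eq_field, dphi]
  refine finsum_congr fun m => ?_
  cases n with
  | zero => rw [Nat.cast_zero, coeff_modeSeries_zero]
  | succ n => rw [coeff_modeSeries_succ]

/-! #### The operator `θ` -/

/-- The series whose Heisenberg operator is `-θ`. -/
def thetaSeries (c : R) : PowerSeries R :=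
  (logSeries R).subst (C (-c) * X) + -(logSeries R).subst (C c * X)

theorem coeff_thetaSeries (c : R) (k : ℕ) :
    coeff k (thetaSeries c) = algebraMap ℚ R (1 / k) * ((-c) ^ k - c ^ k) := by
  have h : ∀ a : R, (logSeries R).subst (C a * X) = rescale a (logSeries R) := by
    intro a
    rw [rescale_eq_subst, smul_eq_C_mul]
  rw [thetaSeries, h, h, map_add, map_neg, coeff_rescale, coeff_rescale, logSeries, coeff_mk]
  ring

theorem oddSeries_thetaSeries (c : R) : OddSeries (thetaSeries c) := by
  intro k hk
  rw [coeff_thetaSeries, hk.neg_pow, sub_self, mul_zero]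

theorem expSeries_thetaSeries (c : R) :
    expSeries (thetaSeries c) = (1 - C c * X) * geom (-c) := by
  have h1 : ∀ a : R, constantCoeff (C a * X) = 0 := fun a => by simp
  have h2 := fun a => constantCoeff_subst_zero (h1 a) (constantCoeff_logSeries (R := R))
  rw [thetaSeries, expSeries_add (h2 _) (by simp [h2]), expSeries_neg_log (h1 c)]
  linear_combination (-(1 - C c * X) * expSeries ((logSeries R).subst (C (-c) * X))) *
    geom_mul_one_sub (-c) + (1 - C c * X) * geom (-c) * expSeries_log_mul (h1 (-c))

theorem finsum_comp_of_support_subset_range {M ι κ : Type*} [AddCommMonoid M] {g : ι → κ}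
    (hg : Function.Injective g) (T : κ → M) (hT : ∀ k, T k ≠ 0 → k ∈ Set.range g) :
    ∑ᶠ k, T k = ∑ᶠ n, T (g n) := by
  rw [← finsum_mem_range hg, ← finsum_mem_univ]
  exact finsum_mem_inter_support_eq' _ _ _ fun k hk => ⟨fun _ => hT k hk, fun _ => trivial⟩

theorem neg_theta_eq_heisSum (β : R) (v : Fock R) :
    -theta β v = heisSum (thetaSeries (half β)) v := by
  rw [theta, ← finsum_neg_distrib, heisSum, locSum_apply (heisSum_finite _)]
  symm
  rw [finsum_comp_of_support_subset_range (g := fun n : ℕ => 2 * n + 1)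
      fun a b h => by simpa using h]
  · refine finsum_congr fun n => ?_
    have hk : ((2 * n + 1 : ℕ) : ℤ) ≠ 0 := by omega
    rw [LinearMap.smul_apply, ← heis_eq_heisLin hk, coeff_thetaSeries,
      (odd_two_mul_add_one n).neg_pow, ← neg_smul]
    rw [half]
    push_cast
    congr 1
    have : algebraMap ℚ R (2 / (2 * (n : ℚ) + 1)) =
        algebraMap ℚ R (1 / (2 * (n : ℚ) + 1)) + algebraMap ℚ R (1 / (2 * (n : ℚ) + 1)) := by
      rw [← map_add]; congr 1; ring
    rw [this]
    ring
  · intro k hk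
    rcases Nat.even_or_odd k with h | ⟨j, hj⟩
    · exact absurd (by simp [oddSeries_thetaSeries _ k h]) hk
    · exact ⟨j, hj.symm⟩

/-! #### The operator `H^{[β]}` -/

/-- The series `∑_{n ≥ 1} p_n X^n / n`. -/
def powerSumSeries (p : ℕ → R) : PowerSeries R := mk fun n => algebraMap ℚ R (1 / n) * p n

theorem constantCoeff_powerSumSeries (p : ℕ → R) : constantCoeff (powerSumSeries p) = 0 := by
  simp [powerSumSeries, ← coeff_zero_eq_constantCoeff_apply]

/-- The series whose Heisenberg operator is `H^{[β]}`. -/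
def hamSeries (c : R) (p : ℕ → R) : PowerSeries R :=
  (powerSumSeries p).subst (zSub c) - (powerSumSeries p).subst (zbarSub c)

theorem coeff_hamSeries (c : R) (p : ℕ → R) {k N : ℕ} (hk : k < N) :
    coeff k (hamSeries c p) = ∑ n ∈ Finset.range N,
      coeff n (powerSumSeries p) * (coeff k (zSub c ^ n) - coeff k (zbarSub c ^ n)) := by
  rw [hamSeries, map_sub, coeff_subst_eq_sum_range (constantCoeff_zSub c) _ hk,
    coeff_subst_eq_sum_range (constantCoeff_zbarSub c) _ hk, ← Finset.sum_sub_distrib]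
  exact Finset.sum_congr rfl fun n _ => (mul_sub _ _ _).symm

theorem oddSeries_hamSeries (c : R) (p : ℕ → R) : OddSeries (hamSeries c p) := by
  intro k hk
  rw [coeff_hamSeries c p (Nat.lt_succ_self k)]
  refine Finset.sum_eq_zero fun n _ => ?_
  rw [coeff_zbarSub_pow, hk.neg_one_pow, one_mul, sub_self, mul_zero]

theorem heisBetaCoeff_eq (β : R) (n k : ℕ) :
    heisBetaCoeff β n k = algebraMap ℚ R (1 / 2) *
      (coeff k (zSub (half β) ^ n) - coeff k (zbarSub (half β) ^ n)) := by
  rw [heisBetaCoeff, map_sub]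
  rfl

/-- Both z^n and z̄^n have order n in t. For n ≥ 1 this also removes k = 0, the index not covered by
`heis_eq_heisLin`. -/
theorem heisBetaCoeff_eq_zero (β : R) {n k : ℕ} (h : k < n) : heisBetaCoeff β n k = 0 := by
  have : coeff k (zSub (half β) ^ n) = 0 := by
    rw [zSub, mul_pow, coeff_X_pow_mul', if_neg (by omega)]
  rw [heisBetaCoeff_eq, coeff_zbarSub_pow, this]
  simp

theorem dheis_eq_sum_range (β : R) {n : ℕ} {v : Fock R} {N : ℕ} (hn : n ≠ 0)
    (hN : ∀ k : ℕ, N ≤ k → heisLin (k : ℤ) v = 0) :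
    dheis β n v = ∑ k ∈ Finset.range N, heisBetaCoeff β n k • heisLin (k : ℤ) v := by
  have h : ∀ k : ℕ, heisBetaCoeff β n k • heis (k : ℤ) v =
      heisBetaCoeff β n k • heisLin (k : ℤ) v := by
    intro k
    rcases eq_or_ne k 0 with rfl | hk
    · rw [heisBetaCoeff_eq_zero β (Nat.pos_of_ne_zero hn), zero_smul, zero_smul]
    · rw [heis_eq_heisLin (by exact_mod_cast hk)]
  rw [dheis]
  simp only [h]
  refine finsum_eq_sum_of_support_subset _ fun k hk => ?_
  by_contra h'
  exact hk (by simp [hN k (by simpa using h')])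

theorem dHam_eq_heisSum (β : R) (p : ℕ → R) (v : Fock R) :
    dHam β p v = heisSum (hamSeries (half β) p) v := by
  obtain ⟨N, hN⟩ := exists_heisLin_eq_zero v
  have hd := fun n : ℕ => dheis_eq_sum_range β (Nat.succ_ne_zero n) hN
  rw [dHam, finsum_eq_sum_of_support_subset (s := Finset.range N), heisSum_eq_sum_range _ hN]
  · simp only [Nat.succ_eq_add_one] at hd
    simp only [hd, Finset.smul_sum]
    rw [Finset.sum_comm]
    refine Finset.sum_congr rfl fun k hk => ?_
    rw [coeff_hamSeries (N := N + 1) _ _ (by have := Finset.mem_range.1 hk; omega),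
      Finset.sum_range_succ']
    have h0 : coeff 0 (powerSumSeries p) = 0 := by
      simpa using constantCoeff_powerSumSeries p
    rw [h0, zero_mul, add_zero, Finset.sum_smul]
    refine Finset.sum_congr rfl fun n _ => ?_
    rw [smul_smul, heisBetaCoeff_eq, powerSumSeries, coeff_mk]
    congr 1
    -- The factor 2 of H^{[β]} cancels the 1/2 in b^{[β]}_n.
    have : algebraMap ℚ R (2 / ((n : ℚ) + 1)) * algebraMap ℚ R (1 / 2) =
        algebraMap ℚ R (1 / ((n + 1 : ℕ) : ℚ)) := by
      rw [← map_mul]; congr 1; push_cast; ring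
    rw [← this]
    ring
  · intro n hn
    by_contra h'
    refine hn ?_
    have h' : N ≤ n := by simpa using h'
    dsimp only
    rw [← Nat.succ_eq_add_one, hd, Finset.sum_eq_zero, smul_zero]
    intro k hk
    have := Finset.mem_range.1 hk
    rw [heisBetaCoeff_eq_zero β (by omega), zero_smul]

end Identification

/-! ### The dual functions as Pfaffians of two-point functions -/

section DualFunctions

variable {R : Type*} [CommRing R] [Algebra ℚ R]

/-- The series by which `e^{-θ}` multiplies the coefficients of a field. -/
def eSeries (c : R) : PowerSeries R :=
  (1 - PowerSeries.C c * PowerSeries.X) * geom (-c)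

/-- Counted from 0, the i-th fermion has i + 1 exponentials on its left, and each contributes one
factor `eSeries`. -/
theorem ketg_eq_word (β : R) (l : List ℕ) :
    ketg β l = word l.length fun i => lau (eSeries (half β)) ^ (i.val + 1) *
      modeSeries (half β) (l.getD i 0 : ℕ) := by
  have hθ : (fun v => -theta β v) = ⇑(heisSum (thetaSeries (half β))) :=
    funext (neg_theta_eq_heisSum β)
  induction l with
  | nil => rfl
  | cons n l ih =>
    have hn := expOp_heisSum_word (oddSeries_thetaSeries (half β)) l.length
      fun i => lau (eSeries (half β)) ^ (i.val + 1) * modeSeries (half β) (l.getD i 0 : ℕ)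
    rw [ketg, dphi_eq_field, hθ, ih,
      (heisSum_nilpotentAt_and_expOp_field (oddSeries_thetaSeries (half β)) _ hn.1).2, hn.2,
      expSeries_thetaSeries]
    change _ = word (l.length + 1) _
    rw [word]
    congr 2
    · simp [eSeries]
    · funext i
      rw [← mul_assoc, ← eSeries, ← pow_succ']
      simp

/-- The coefficient series of the `i`-th field in `⟨0| e^{H} |λ⟩`. -/
def entrySeries (β : R) (p : ℕ → R) (lam : List ℕ) (i : ℕ) : LaurentSeries R :=
  lau (expSeries (hamSeries (half β) p)) * (lau (eSeries (half β)) ^ (i + 1) *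
    modeSeries (half β) (lam.getD i 0 : ℕ))

theorem dualO_eq_pfaffian (β : R) (p : ℕ → R) (lam : List ℕ) :
    dualO β p lam = algebraMap ℚ R ((1 / 2) ^ lam.length) *
      pfaffian ((lam.length + 1) / 2) fun i j =>
        twoPoint (entrySeries β p lam i) (entrySeries β p lam j) := by
  have hH : dHam β p = ⇑(heisSum (hamSeries (half β) p)) := funext (dHam_eq_heisSum β p)
  rw [dualO, hH]
  congr 1
  have hlen : (if Even lam.length then lam else lam ++ [0]).length =
      2 * ((lam.length + 1) / 2) := by
    split_ifs with h
    · obtain ⟨k, hk⟩ := h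
      omega
    · rw [List.length_append, List.length_singleton]
      obtain ⟨k, hk⟩ := Nat.not_even_iff_odd.1 h
      omega
  -- Padding by a part 0 is invisible here, because 0 is also the default value past the end of the
  -- list.
  have hget : ∀ i, (if Even lam.length then lam else lam ++ [0]).getD i 0 = lam.getD i 0 := by
    intro i
    split_ifs with h
    · rfl
    · rcases lt_or_ge i lam.length with hi | hi
      · rw [List.getD_append _ _ _ _ hi]
      · rw [List.getD_append_right _ _ _ _ hi, List.getD_eq_default _ _ hi]
        rcases i - lam.length with _ | k <;> simp
  rw [ketg_eq_word, (expOp_heisSum_word (oddSeries_hamSeries _ p) _ _).2, hlen]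
  simp only [hget]
  exact vev_word_two_mul _ fun i => entrySeries β p lam i

end DualFunctions

/-! ### Two-point functions of the deformed fermions -/

section PairCoeff

variable {R : Type*} [CommRing R]

theorem twoPoint_add_left (f f' g : LaurentSeries R) :
    twoPoint (f + f') g = twoPoint f g + twoPoint f' g := by simp [twoPoint]

theorem twoPoint_add_right (f g g' : LaurentSeries R) :
    twoPoint f (g + g') = twoPoint f g + twoPoint f g' := by simp [twoPoint]

theorem twoPoint_smul_left (r : R) (f g : LaurentSeries R) :
    twoPoint (r • f) g = r * twoPoint f g := by simp [twoPoint]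

theorem twoPoint_smul_right (r : R) (f g : LaurentSeries R) :
    twoPoint f (r • g) = r * twoPoint f g := by simp [twoPoint]

theorem twoPoint_sum_left {ι : Type*} (s : Finset ι) (f : ι → LaurentSeries R)
    (g : LaurentSeries R) : twoPoint (∑ k ∈ s, f k) g = ∑ k ∈ s, twoPoint (f k) g := by
  simp [twoPoint]

theorem twoPoint_sum_right {ι : Type*} (s : Finset ι) (f : LaurentSeries R)
    (g : ι → LaurentSeries R) : twoPoint f (∑ k ∈ s, g k) = ∑ k ∈ s, twoPoint f (g k) := by
  simp [twoPoint]

/-- Only products f_m g_{-m} with m ≥ 0 enter the pairing. The asymmetry in f and g is that of the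
region |w| < |z|. -/
theorem twoPoint_eq_zero {a b : ℤ} {f g : LaurentSeries R} (hf : VanishesBelow a f)
    (hg : VanishesBelow b g) (h : 0 < a + b ∨ 0 < b) : twoPoint f g = 0 := by
  rw [twoPoint_eq_sum_range f g b.natAbs.succ fun m hm => hg _ (by omega)]
  refine Finset.sum_eq_zero fun m _ => ?_
  rcases lt_or_ge (m : ℤ) a with h1 | h1
  · rw [hf _ h1]; ring
  · rw [hg (-m) (by omega)]; ring

theorem lau_C_mul (r : R) (f : LaurentSeries R) : lau (PowerSeries.C r) * f = r • f := by
  rw [lau, HahnSeries.ofPowerSeries_C, HahnSeries.C_mul_eq_smul]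

/-- The norms 2(-1)^m alternate, so neighbouring terms cancel; the exceptional norm 1 at m = 0
leaves the boundary terms. This is the origin of (z - w)/(z + w + βzw). -/
theorem twoPoint_shift (F G : LaurentSeries R) :
    twoPoint (HahnSeries.single 1 1 * F) G + twoPoint F (HahnSeries.single 1 1 * G) =
      F.coeff (-1) * G.coeff 0 - F.coeff 0 * G.coeff (-1) := by
  obtain ⟨L, hL⟩ := exists_vanishesBelow G
  set N := L.natAbs + 1
  have hG : ∀ m : ℕ, N ≤ m → G.coeff (-m) = 0 := fun m hm => hL _ (by omega)
  have hz : ∀ (H : LaurentSeries R) (n : ℤ),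
      (HahnSeries.single 1 1 * H : LaurentSeries R).coeff n = H.coeff (n - 1) := fun H n => by
    rw [HahnSeries.coeff_single_mul, one_mul]
  rw [twoPoint_eq_sum_range _ G (N + 1) fun m hm => hG m (by omega),
    twoPoint_eq_sum_range F _ N fun m hm => by
      rw [hz, show (-(m : ℤ) - 1) = -((m + 1 : ℕ) : ℤ) by push_cast; ring]
      exact hG _ (by omega),
    Finset.sum_range_succ', add_right_comm, ← Finset.sum_add_distrib,
    Finset.sum_range_succ' _ L.natAbs]
  rw [Finset.sum_eq_zero]
  · simp only [hz, modeNorm]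
    norm_num
    ring
  · intro k _
    rw [hz, hz, modeNorm, modeNorm, if_neg (by omega), if_neg (by omega)]
    push_cast
    rw [show (k : ℤ) + 1 + 1 - 1 = k + 1 by ring,
      show -((k : ℤ) + 1) - 1 = -(k + 1 + 1) by ring]
    ring

/-- These are the boundary values needed in `twoPoint_shift`. For p ≥ 2 the series is t^{-p}(1 -
ct)^{p-2}, all of whose exponents are at most -2. -/
theorem coeff_geom_mul_modeSeries (c : R) (p : ℤ) :
    (lau (geom c) * modeSeries c p).coeff (-1) = (if p = 1 then 1 else 0) ∧
      (lau (geom c) * modeSeries c p).coeff 0 =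
        if p = 0 then 1 else if p = 1 then c else 0 := by
  have hc : ∀ (f : PowerSeries R) (n : ℕ), n ≠ 0 → (lau f).coeff (-n : ℤ) = 0 := by
    intro f n hn
    rw [PowerSeries.coeff_coe, if_pos (by omega)]
  rcases lt_trichotomy p 0 with hp | rfl | hp
  · have := (vanishesBelow_ofPowerSeries (geom c)).mul (vanishesBelow_modeSeries c p)
    rw [this _ (by omega), this _ (by omega), if_neg (by omega), if_neg (by omega),
      if_neg (by omega)]
    simp
  · rw [modeSeries_zero, lau, ← map_mul, PowerSeries.coeff_coe, PowerSeries.coeff_coe]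
    simp [constantCoeff_geom]
  · obtain ⟨n, rfl⟩ : ∃ n : ℕ, p = (n + 1 : ℕ) := ⟨p.toNat - 1, by omega⟩
    cases n with
    | zero =>
      rw [modeSeries_succ, pow_zero, mul_left_comm, lau, lau, ← map_mul, mul_one,
        HahnSeries.coeff_single_mul, HahnSeries.coeff_single_mul, PowerSeries.coeff_coe,
        PowerSeries.coeff_coe]
      simp [geom]
    | succ n =>
      have h : lau (geom c) * modeSeries c ((n + 1 + 1 : ℕ) : ℤ) =
          HahnSeries.single (-(n + 1 + 1 : ℕ) : ℤ) 1 *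
            lau ((1 - PowerSeries.C c * PowerSeries.X) ^ n) := by
        rw [modeSeries_succ, mul_left_comm, lau, lau, ← map_mul, pow_succ', ← mul_assoc,
          geom_mul_one_sub, one_mul]
      rw [h, HahnSeries.coeff_single_mul, HahnSeries.coeff_single_mul, PowerSeries.coeff_coe,
        PowerSeries.coeff_coe, if_neg (by omega), if_neg (by omega), coeff_one_sub_pow,
        coeff_one_sub_pow, Nat.choose_eq_zero_of_lt (by omega),
        Nat.choose_eq_zero_of_lt (by omega), if_neg (by omega), if_neg (by omega),
        if_neg (by omega)]
      simp

variable [Algebra ℚ R]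

theorem eSeries_mul (β : R) :
    eSeries (half β) * (1 + PowerSeries.C β * zSub (half β)) = 1 := by
  have h1 := geom_mul_one_sub (half β)
  have h2 := geom_mul_one_sub (-half β)
  rw [map_neg] at h2
  have h3 : PowerSeries.C β = PowerSeries.C (half β) + PowerSeries.C (half β) := by
    rw [← map_add, half_add_half]
  rw [eSeries, zSub, h3]
  linear_combination h2 + 2 * geom (-half β) * PowerSeries.C (half β) * PowerSeries.X * h1

/-- The two-point function of two deformed fermions, after conjugation by powers of `e^{-θ}`. -/
def pairCoeff (β : R) (i j : ℕ) (p q : ℤ) : R :=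
  twoPoint (lau (eSeries (half β)) ^ i * modeSeries (half β) p)
    (lau (eSeries (half β)) ^ j * modeSeries (half β) q)

theorem vanishesBelow_eSeries_pow_mul (β : R) (i : ℕ) (p : ℤ) :
    VanishesBelow (-p) (lau (eSeries (half β)) ^ i * modeSeries (half β) p) := by
  rw [lau, ← map_pow]
  exact ((vanishesBelow_ofPowerSeries _).mul (vanishesBelow_modeSeries _ p)).mono (by omega)

theorem pairCoeff_eq_zero (β : R) (i j : ℕ) {p q : ℤ} (h : p + q < 0 ∨ q < 0) :
    pairCoeff β i j p q = 0 :=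
  twoPoint_eq_zero (vanishesBelow_eSeries_pow_mul β i p) (vanishesBelow_eSeries_pow_mul β j q)
    (by omega)

/-- Insert 1 = E(1 + βz), with E = `eSeries`; multiplication by z lowers the mode by one. -/
theorem eSeries_pow_mul_modeSeries (β : R) (i : ℕ) (p : ℤ) :
    lau (eSeries (half β)) ^ i * modeSeries (half β) p =
      lau (eSeries (half β)) ^ (i + 1) * modeSeries (half β) p +
        β • (lau (eSeries (half β)) ^ (i + 1) * modeSeries (half β) (p - 1)) := by
  have h := congrArg (HahnSeries.ofPowerSeries ℤ R) (eSeries_mul β)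
  rw [map_mul, map_add, map_one, map_mul] at h
  rw [← lau_zSub_mul_modeSeries, ← lau_C_mul]
  simp only [lau]
  linear_combination (-(HahnSeries.ofPowerSeries ℤ R (eSeries (half β)) ^ i *
    modeSeries (half β) p)) * h

theorem pairCoeff_succ_left (β : R) (i j : ℕ) (p q : ℤ) :
    pairCoeff β i j p q = pairCoeff β (i + 1) j p q + β * pairCoeff β (i + 1) j (p - 1) q := by
  rw [pairCoeff, eSeries_pow_mul_modeSeries, twoPoint_add_left, twoPoint_smul_left]
  rfl

theorem pairCoeff_succ_right (β : R) (i j : ℕ) (p q : ℤ) :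
    pairCoeff β i j p q = pairCoeff β i (j + 1) p q + β * pairCoeff β i (j + 1) p (q - 1) := by
  rw [pairCoeff, eSeries_pow_mul_modeSeries β j, twoPoint_add_right, twoPoint_smul_right]
  rfl

/-- With A = z^{-p}/(1 - ct)^2, the modes p - 1 and p are tA and (1 - ct)A; take B likewise for q.
The coefficient of ⟨tA, tB⟩ is β - 2c = 0, and what is left is the shift identity for A and B. -/
theorem pairCoeff_zero_zero (β : R) (p q : ℤ) :
    pairCoeff β 0 0 (p - 1) q + pairCoeff β 0 0 p (q - 1) +
        β * pairCoeff β 0 0 (p - 1) (q - 1) =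
      (if p = 1 ∧ q = 0 then 1 else 0) - if p = 0 ∧ q = 1 then 1 else 0 := by
  have h := congrArg (HahnSeries.ofPowerSeries ℤ R) (geom_mul_one_sub (half β))
  rw [map_mul, map_one, map_sub, map_one, map_mul, HahnSeries.ofPowerSeries_C,
    HahnSeries.ofPowerSeries_X] at h
  have h0 : ∀ n, modeSeries (half β) n = lau (geom (half β)) * modeSeries (half β) n +
      (-half β) • (HahnSeries.single 1 1 * (lau (geom (half β)) * modeSeries (half β) n)) := by
    intro n
    rw [← HahnSeries.C_mul_eq_smul, map_neg]
    simp only [lau]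
    linear_combination (-modeSeries (half β) n) * h
  have h1 : ∀ n, modeSeries (half β) (n - 1) =
      HahnSeries.single 1 1 * (lau (geom (half β)) * modeSeries (half β) n) := by
    intro n
    rw [← lau_zSub_mul_modeSeries, zSub, lau, map_mul, HahnSeries.ofPowerSeries_X, mul_assoc]
  obtain ⟨p1, p2⟩ := coeff_geom_mul_modeSeries (half β) p
  obtain ⟨q1, q2⟩ := coeff_geom_mul_modeSeries (half β) q
  have key := twoPoint_shift (lau (geom (half β)) * modeSeries (half β) p)
    (lau (geom (half β)) * modeSeries (half β) q)
  rw [p1, p2, q1, q2] at key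
  simp only [pairCoeff, pow_zero, one_mul]
  rw [h1 p, h1 q]
  conv_lhs => enter [1, 1]; rw [h0 q]
  conv_lhs => enter [1, 2]; rw [h0 p]
  simp only [twoPoint_add_left, twoPoint_add_right, twoPoint_smul_left, twoPoint_smul_right]
  have hβ := half_add_half β
  set T := twoPoint (HahnSeries.single 1 1 * (lau (geom (half β)) * modeSeries (half β) p))
    (HahnSeries.single 1 1 * (lau (geom (half β)) * modeSeries (half β) q))
  have e : (if p = 1 then (1 : R) else 0) * (if q = 0 then 1 else if q = 1 then half β else 0) -
      (if p = 0 then 1 else if p = 1 then half β else 0) * (if q = 1 then 1 else 0) =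
      (if p = 1 ∧ q = 0 then 1 else 0) - if p = 0 ∧ q = 1 then 1 else 0 := by
    by_cases hp1 : p = 1 <;> by_cases hp0 : p = 0 <;> by_cases hq1 : q = 1 <;>
      by_cases hq0 : q = 0 <;> first | omega | simp [hp1, hp0, hq1, hq0]
  linear_combination key + e - T * hβ

end PairCoeff

/-! ### Change of the ring of scalars -/

section Functoriality

variable {R S : Type*} [CommRing R] [CommRing S]

/-- The map of Laurent series induced by a ring homomorphism. -/
def laurentMap (φ : R →+* S) : LaurentSeries R →+* LaurentSeries S where
  toFun f := HahnSeries.map f φ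
  map_one' := HahnSeries.map_one φ.toMonoidWithZeroHom
  map_mul' _ _ := HahnSeries.map_mul (φ : R →ₙ+* S)
  map_zero' := HahnSeries.map_zero (φ : ZeroHom R S)
  map_add' _ _ := HahnSeries.map_add (φ : R →+ S)

@[simp]
theorem coeff_laurentMap (φ : R →+* S) (f : LaurentSeries R) (n : ℤ) :
    (laurentMap φ f).coeff n = φ (f.coeff n) := rfl

theorem laurentMap_lau (φ : R →+* S) (f : PowerSeries R) :
    laurentMap φ (lau f) = lau (PowerSeries.map φ f) := by
  ext n
  rw [coeff_laurentMap, PowerSeries.coeff_coe, PowerSeries.coeff_coe, PowerSeries.coeff_map]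
  split_ifs <;> simp

theorem laurentMap_single (φ : R →+* S) (n : ℤ) (r : R) :
    laurentMap φ (HahnSeries.single n r) = HahnSeries.single n (φ r) := by
  ext m
  rw [coeff_laurentMap, HahnSeries.coeff_single, HahnSeries.coeff_single]
  split_ifs <;> simp

theorem laurentMap_modeSeries (φ : R →+* S) (c : R) (n : ℤ) :
    laurentMap φ (modeSeries c n) = modeSeries (φ c) n := by
  have h : Units.map (laurentMap φ : LaurentSeries R →* LaurentSeries S) (zInv c) =
      zInv (φ c) := by
    ext1
    simp [zInv, laurentMap_lau, laurentMap_single]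
  rw [modeSeries, modeSeries, map_mul, laurentMap_lau, map_geom, ← h, ← map_zpow]
  rfl

theorem map_twoPoint (φ : R →+* S) (f g : LaurentSeries R) :
    φ (twoPoint f g) = twoPoint (laurentMap φ f) (laurentMap φ g) := by
  obtain ⟨L, hL⟩ := exists_vanishesBelow g
  have hg : ∀ m : ℕ, L.natAbs + 1 ≤ m → g.coeff (-m) = 0 := fun m hm => hL _ (by omega)
  rw [twoPoint_eq_sum_range f g _ hg, twoPoint_eq_sum_range _ _ (L.natAbs + 1) fun m hm => by
    rw [coeff_laurentMap, hg m hm, map_zero], map_sum]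
  refine Finset.sum_congr rfl fun m _ => ?_
  simp only [modeNorm, map_mul, coeff_laurentMap]
  split_ifs <;> simp [map_ofNat]

variable [Algebra ℚ R] [Algebra ℚ S]

theorem map_half (φ : R →+* S) (β : R) : φ (half β) = half (φ β) := by
  rw [half, map_mul, RingHom.map_rat_algebraMap]

/-- Two-point functions are finite sums of products of coefficients, and these are polynomial in β
with rational coefficients. This moves results between ℚ[β], ℚ(β) and `Ser`. -/
theorem map_pairCoeff (φ : R →+* S) (β : R) (i j : ℕ) (p q : ℤ) :
    φ (pairCoeff β i j p q) = pairCoeff (φ β) i j p q := by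
  have h : PowerSeries.map φ (eSeries (half β)) = eSeries (half (φ β)) := by
    rw [← map_half, eSeries, eSeries, map_mul, map_sub, map_one, map_geom, map_mul,
      PowerSeries.map_C, PowerSeries.map_X, map_neg]
  rw [pairCoeff, map_twoPoint, map_mul, map_mul, map_pow, map_pow, laurentMap_lau, h,
    laurentMap_modeSeries, laurentMap_modeSeries, map_half]
  rfl

end Functoriality

/-! ### The expansion coefficients `g` -/

section Expansion

variable {F : Type*} [Field F]

variable (F) in
/-- The variable `z` of `F((z))((w))`. -/
def zVar : LaurentSeries (LaurentSeries F) := HahnSeries.C (HahnSeries.single (1 : ℤ) (1 : F))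

variable (F) in
/-- The variable `w` of `F((z))((w))`. -/
def wVar : LaurentSeries (LaurentSeries F) := HahnSeries.single (1 : ℤ) (1 : LaurentSeries F)

/-- A constant as an element of `F((z))((w))`. -/
def betaVar (β : F) : LaurentSeries (LaurentSeries F) := HahnSeries.C (HahnSeries.C β)

/-- The element of `k((z))((w))` with coefficients `f p q` at `z^p w^q`, for `f` supported on
`p + q ≥ 0`, `q ≥ 0`. -/
def doubleSeries (f : ℤ → ℤ → F) : LaurentSeries (LaurentSeries F) :=
  HahnSeries.ofPowerSeries ℤ (LaurentSeries F) (PowerSeries.mk fun q : ℕ =>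
    HahnSeries.single (-q : ℤ) 1 *
      HahnSeries.ofPowerSeries ℤ F (PowerSeries.mk fun n : ℕ => f (n - q) q))

theorem coeff_doubleSeries {f : ℤ → ℤ → F} (hf : ∀ p q, p + q < 0 ∨ q < 0 → f p q = 0)
    (p q : ℤ) : ((doubleSeries f).coeff q).coeff p = f p q := by
  rw [doubleSeries, PowerSeries.coeff_coe]
  split_ifs with h
  · rw [hf p q (Or.inr h)]
    rfl
  · rw [PowerSeries.coeff_mk, HahnSeries.coeff_single_mul, PowerSeries.coeff_coe, one_mul]
    split_ifs with h'
    · rw [hf p q (Or.inl (by omega))]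
    · rw [PowerSeries.coeff_mk]
      congr 1 <;> omega

theorem coeff_zVar_mul (x : LaurentSeries (LaurentSeries F)) (p q : ℤ) :
    ((zVar F * x).coeff q).coeff p = (x.coeff q).coeff (p - 1) := by
  rw [zVar, HahnSeries.C_mul_eq_smul, HahnSeries.coeff_smul, smul_eq_mul,
    HahnSeries.coeff_single_mul, one_mul]

theorem coeff_wVar_mul (x : LaurentSeries (LaurentSeries F)) (p q : ℤ) :
    ((wVar F * x).coeff q).coeff p = (x.coeff (q - 1)).coeff p := by
  rw [wVar, HahnSeries.coeff_single_mul, one_mul]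

theorem coeff_betaVar_mul (β : F) (x : LaurentSeries (LaurentSeries F)) (p q : ℤ) :
    ((betaVar β * x).coeff q).coeff p = β * (x.coeff q).coeff p := by
  rw [betaVar, HahnSeries.C_mul_eq_smul, HahnSeries.coeff_smul, smul_eq_mul,
    HahnSeries.C_mul_eq_smul, HahnSeries.coeff_smul, smul_eq_mul]

theorem coeff_one_double (p q : ℤ) :
    ((1 : LaurentSeries (LaurentSeries F)).coeff q).coeff p = if q = 0 ∧ p = 0 then (1 : F) else 0 := by
  rw [HahnSeries.coeff_one]
  by_cases hq : q = 0
  · simp [hq, HahnSeries.coeff_one]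
  · simp [hq]

theorem double_ext {x y : LaurentSeries (LaurentSeries F)} (h : ∀ p q, (x.coeff q).coeff p = (y.coeff q).coeff p) : x = y := by
  ext q p
  exact h p q

theorem one_add_betaVar_mul_zVar_ne_zero (β : F) : 1 + betaVar β * zVar F ≠ 0 := by
  intro h
  have h1 := congrArg (fun x : LaurentSeries (LaurentSeries F) => (x.coeff 0).coeff 0) h
  rw [← mul_one (zVar F)] at h1
  simp [-mul_one, coeff_betaVar_mul, coeff_zVar_mul] at h1

theorem one_add_betaVar_mul_wVar_ne_zero (β : F) : 1 + betaVar β * wVar F ≠ 0 := by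
  intro h
  have h1 := congrArg (fun x : LaurentSeries (LaurentSeries F) => (x.coeff 0).coeff 0) h
  rw [← mul_one (wVar F)] at h1
  simp [-mul_one, coeff_betaVar_mul, coeff_wVar_mul] at h1

theorem zVar_add_wVar_ne_zero (β : F) : zVar F + wVar F + betaVar β * zVar F * wVar F ≠ 0 := by
  intro h
  -- The coefficient of z in w-degree 0 is 1.
  have h1 := congrArg (fun x : LaurentSeries (LaurentSeries F) => (x.coeff 0).coeff 1) h
  rw [mul_assoc, ← mul_one (zVar F), ← mul_one (wVar F), mul_assoc (zVar F)] at h1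
  simp [-mul_one, coeff_betaVar_mul, coeff_wVar_mul, coeff_zVar_mul] at h1

variable [Algebra ℚ F]

/-- The series of the two-point functions. -/
def pairSeries (β : F) (i j : ℕ) : LaurentSeries (LaurentSeries F) := doubleSeries (pairCoeff β i j)

theorem coeff_pairSeries (β : F) (i j : ℕ) (p q : ℤ) :
    ((pairSeries β i j).coeff q).coeff p = pairCoeff β i j p q :=
  coeff_doubleSeries (f := pairCoeff β i j) (fun _ _ h => pairCoeff_eq_zero β i j h) p q

theorem pairSeries_succ_left (β : F) (i j : ℕ) :
    (1 + betaVar β * zVar F) * pairSeries β (i + 1) j = pairSeries β i j := by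
  refine double_ext fun p q => ?_
  rw [add_mul, one_mul, mul_assoc, HahnSeries.coeff_add, HahnSeries.coeff_add, coeff_betaVar_mul,
    coeff_zVar_mul, coeff_pairSeries, coeff_pairSeries, coeff_pairSeries,
    pairCoeff_succ_left β i j]

theorem pairSeries_succ_right (β : F) (i j : ℕ) :
    (1 + betaVar β * wVar F) * pairSeries β i (j + 1) = pairSeries β i j := by
  refine double_ext fun p q => ?_
  rw [add_mul, one_mul, mul_assoc, HahnSeries.coeff_add, HahnSeries.coeff_add, coeff_betaVar_mul,
    coeff_wVar_mul, coeff_pairSeries, coeff_pairSeries, coeff_pairSeries,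
    pairCoeff_succ_right β i j]

theorem pairSeries_zero_zero (β : F) :
    (zVar F + wVar F + betaVar β * zVar F * wVar F) * pairSeries β 0 0 = zVar F - wVar F := by
  refine double_ext fun p q => ?_
  rw [add_mul, add_mul, mul_assoc, mul_assoc, HahnSeries.coeff_add, HahnSeries.coeff_add,
    HahnSeries.coeff_add, HahnSeries.coeff_add, coeff_betaVar_mul, coeff_zVar_mul, coeff_zVar_mul,
    coeff_wVar_mul, coeff_wVar_mul, coeff_pairSeries, coeff_pairSeries, coeff_pairSeries,
    pairCoeff_zero_zero, ← mul_one (zVar F), ← mul_one (wVar F), HahnSeries.coeff_sub, HahnSeries.coeff_sub,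
    coeff_zVar_mul, coeff_wVar_mul, coeff_one_double, coeff_one_double]
  congr 2 <;> simp only [eq_iff_iff] <;> omega

/-- The series of two-point functions and the rational function satisfy the same linear equations,
with nonzero coefficients in a field. -/
theorem coeff_expansion_eq_pairCoeff (β : F) (i j : ℕ) (p q : ℤ) :
    (((((1 + betaVar β * zVar F) ^ i)⁻¹ * ((1 + betaVar β * wVar F) ^ j)⁻¹ *
      ((zVar F - wVar F) / (zVar F + wVar F + betaVar β * zVar F * wVar F))).coeff q).coeff p) =
      pairCoeff β i j p q := by
  have h0 : pairSeries β 0 0 = (zVar F - wVar F) /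
      (zVar F + wVar F + betaVar β * zVar F * wVar F) :=
    (eq_div_iff (zVar_add_wVar_ne_zero β)).2 (by rw [mul_comm, pairSeries_zero_zero])
  have hi : ∀ i, (1 + betaVar β * zVar F) ^ i * pairSeries β i 0 = pairSeries β 0 0 := by
    intro i
    induction i with
    | zero => simp
    | succ i ih => rw [pow_succ, mul_assoc, pairSeries_succ_left, ih]
  have hj : ∀ j, (1 + betaVar β * wVar F) ^ j * pairSeries β i j = pairSeries β i 0 := by
    intro j
    induction j with
    | zero => simp
    | succ j ih => rw [pow_succ, mul_assoc, pairSeries_succ_right, ih]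
  have hz := pow_ne_zero i (one_add_betaVar_mul_zVar_ne_zero β)
  have hw := pow_ne_zero j (one_add_betaVar_mul_wVar_ne_zero β)
  rw [← h0, ← hi i, ← hj j, mul_assoc, mul_left_comm _ ((1 + betaVar β * zVar F) ^ i),
    inv_mul_cancel_left₀ hz, inv_mul_cancel_left₀ hw, coeff_pairSeries]

theorem gCoeff_eq_pairCoeff (i j : ℕ) (p q : ℤ) : gCoeff i j p q = pairCoeff betaK i j p q :=
  coeff_expansion_eq_pairCoeff betaK i j p q

theorem gCoeff_mem_range (i j : ℕ) (p q : ℤ) :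
    gCoeff i j p q ∈ Set.range (algebraMap (Polynomial ℚ) K) := by
  refine ⟨pairCoeff Polynomial.X i j p q, ?_⟩
  rw [map_pairCoeff, RatFunc.algebraMap_X, gCoeff_eq_pairCoeff]

theorem C_gCoeff (i j : ℕ) (p q : ℤ) :
    MvPowerSeries.C (gCoeff i j p q) = pairCoeff betaS i j p q := by
  rw [gCoeff_eq_pairCoeff, map_pairCoeff]
  rfl

theorem gLast_eq_coeff_geom (i p : ℕ) :
    gLast i p = PowerSeries.coeff p (geom (-betaK) ^ i) := by
  have h := geom_mul_one_sub (-betaK)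
  rw [map_neg, neg_mul, sub_neg_eq_add] at h
  have h1 : PowerSeries.constantCoeff
      (((1 : PowerSeries K) + PowerSeries.C betaK * PowerSeries.X) ^ i) ≠ 0 := by simp
  rw [gLast]
  congr 1
  rw [PowerSeries.inv_eq_iff_mul_eq_one h1, ← mul_pow, h, one_pow]

theorem gLast_mem_range (i p : ℕ) : gLast i p ∈ Set.range (algebraMap (Polynomial ℚ) K) := by
  refine ⟨PowerSeries.coeff p (geom (-Polynomial.X) ^ i), ?_⟩
  rw [gLast_eq_coeff_geom, ← PowerSeries.coeff_map, map_pow, map_geom, map_neg,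
    RatFunc.algebraMap_X]

theorem C_gLast (i p : ℕ) :
    (MvPowerSeries.C (gLast i p) : Ser) = PowerSeries.coeff p (geom (-betaS) ^ i) := by
  rw [gLast_eq_coeff_geom, ← PowerSeries.coeff_map, map_pow, map_geom, map_neg]
  rfl

end Expansion

/-! ### Expansion of two-point functions in the functions `q` -/

section QExpansion

variable {R : Type*} [CommRing R]

open PowerSeries

theorem zSub_pow_mul_modeSeries (c : R) (k : ℕ) (n : ℤ) :
    lau (zSub c) ^ k * modeSeries c n = modeSeries c (n - k) := by
  induction k with
  | zero => simp
  | succ k ih =>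
    rw [pow_succ', mul_assoc, ih, lau_zSub_mul_modeSeries]
    congr 1
    push_cast
    ring

/-- Multiplication of a mode series by a power series in `z`, up to terms of large order. -/
theorem subst_mul_modeSeries (c : R) (Q : PowerSeries R) (g : PowerSeries R) (n : ℤ) (N : ℕ) :
    ∃ r, VanishesBelow (N - n) r ∧ lau (Q.subst (zSub c)) * (lau g * modeSeries c n) =
      ∑ k ∈ Finset.range N, coeff k Q • (lau g * modeSeries c (n - k)) + r := by
  obtain ⟨s, hs⟩ := subst_eq_sum_add (constantCoeff_zSub c) Q N
  refine ⟨lau (zSub c ^ N * s) * (lau g * modeSeries c n), ?_, ?_⟩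
  · rw [lau, map_mul, map_pow]
    have h1 := (vanishesBelow_one_of_constantCoeff (constantCoeff_zSub c)).pow N
    have h2 := (h1.mul (vanishesBelow_ofPowerSeries s)).mul
      ((vanishesBelow_ofPowerSeries g).mul (vanishesBelow_modeSeries c n))
    exact h2.mono (by omega)
  · rw [hs, lau, map_add, add_mul, map_sum, Finset.sum_mul]
    congr 1
    refine Finset.sum_congr rfl fun k _ => ?_
    rw [map_mul, ← zSub_pow_mul_modeSeries, ← lau_C_mul, lau, lau, lau, map_pow]
    ring

theorem coeff_zero_modeSeries (c : R) (n : ℕ) :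
    (modeSeries c n).coeff 0 = if n = 0 then 1 else 0 := by
  cases n with
  | zero =>
    rw [Nat.cast_zero, modeSeries_zero, coeff_coe]
    simp [constantCoeff_geom]
  | succ n =>
    rw [modeSeries_succ, HahnSeries.coeff_single_mul, coeff_coe, if_neg (by omega),
      coeff_one_sub_pow, Nat.choose_eq_zero_of_lt (by omega), if_neg (by omega)]
    simp

/-- Residue form: z^{-n}/(1 - ct) · dt/t = z^{-n-1} dz, so the t^0-coefficient is the residue of
Q(z) z^{-n-1} dz. -/
theorem coeff_zero_subst_mul_modeSeries (c : R) (Q : PowerSeries R) (n : ℕ) :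
    (lau (Q.subst (zSub c)) * modeSeries c n).coeff 0 = coeff n Q := by
  obtain ⟨r, hr, h⟩ := subst_mul_modeSeries c Q 1 n (n + 1)
  simp only [lau, map_one, one_mul] at h
  rw [h, HahnSeries.coeff_add, hr 0 (by push_cast; omega), add_zero, HahnSeries.coeff_sum,
    Finset.sum_eq_single_of_mem n (by simp)]
  · have := coeff_zero_modeSeries c 0
    rw [HahnSeries.coeff_smul, sub_self]
    simp at this
    simp [this]
  · intro k hk hkn
    have hk' : k < n := by
      have := Finset.mem_range.1 hk
      omega
    rw [HahnSeries.coeff_smul, show (n : ℤ) - k = ((n - k : ℕ) : ℤ) by omega,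
      coeff_zero_modeSeries, if_neg (by omega), smul_zero]

variable [Algebra ℚ R]

/-- The truncation error on the left pairs to zero because p + q < N, the one on the right because q
< N. -/
theorem twoPoint_subst (β : R) (Q : PowerSeries R) (i j : ℕ) {p q : ℤ} {N : ℕ}
    (hpq : p + q < N) (hq : q < N) :
    twoPoint (lau (Q.subst (zSub (half β))) *
        (lau (eSeries (half β)) ^ i * modeSeries (half β) p))
      (lau (Q.subst (zSub (half β))) * (lau (eSeries (half β)) ^ j * modeSeries (half β) q)) =
      ∑ k ∈ Finset.range N, ∑ l ∈ Finset.range N,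
        pairCoeff β i j (p - k) (q - l) * (coeff k Q * coeff l Q) := by
  obtain ⟨r, hr, h⟩ := subst_mul_modeSeries (half β) Q (eSeries (half β) ^ i) p N
  obtain ⟨s, hs, h'⟩ := subst_mul_modeSeries (half β) Q (eSeries (half β) ^ j) q N
  have hg : VanishesBelow (-q) (lau (Q.subst (zSub (half β))) *
      (lau (eSeries (half β)) ^ j * modeSeries (half β) q)) :=
    ((vanishesBelow_ofPowerSeries _).mul (vanishesBelow_eSeries_pow_mul β j q)).mono (by omega)
  have he : ∀ i, lau (eSeries (half β) ^ i) = lau (eSeries (half β)) ^ i := fun i =>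
    map_pow (HahnSeries.ofPowerSeries ℤ R) _ _
  simp only [he] at h h'
  rw [h, twoPoint_add_left, twoPoint_eq_zero hr hg (by omega), add_zero, twoPoint_sum_left]
  refine Finset.sum_congr rfl fun k _ => ?_
  rw [h', twoPoint_add_right, twoPoint_smul_left, twoPoint_smul_left,
    twoPoint_eq_zero (vanishesBelow_eSeries_pow_mul β i _) hs (by omega), mul_zero, add_zero,
    twoPoint_sum_right, Finset.mul_sum]
  refine Finset.sum_congr rfl fun l _ => ?_
  rw [twoPoint_smul_right, ← pairCoeff]
  ring

theorem subst_geom_neg (β : R) : (geom (-β)).subst (zSub (half β)) = eSeries (half β) := by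
  have hs := HasSubst.of_constantCoeff_zero' (constantCoeff_zSub (half β))
  have h := congrArg (PowerSeries.subst (zSub (half β))) (geom_mul_one_sub (-β))
  rw [map_neg, neg_mul, sub_neg_eq_add, subst_mul hs, subst_add hs, subst_mul hs,
    subst_X hs, subst_C, ← coe_substAlgHom hs, map_one] at h
  have h' := eSeries_mul β
  change _ * (1 + C β * _) = 1 at h
  rw [coe_substAlgHom hs] at h
  linear_combination eSeries (half β) * h - (geom (-β)).subst (zSub (half β)) * h'

/-- The second argument is a power series in t with constant term 1, so only m = 0 enters the
pairing, and it returns the t^0-coefficient of the first argument. -/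
theorem twoPoint_subst_zero (β : R) {Q : PowerSeries R} (hQ : constantCoeff Q = 1) (i j : ℕ)
    (n : ℕ) :
    twoPoint (lau (Q.subst (zSub (half β))) *
        (lau (eSeries (half β)) ^ i * modeSeries (half β) n))
      (lau (Q.subst (zSub (half β))) *
        (lau (eSeries (half β)) ^ j * modeSeries (half β) (0 : ℕ))) =
      ∑ k ∈ Finset.range (n + 1), coeff k (geom (-β) ^ i) * coeff (n - k) Q := by
  have hs := HasSubst.of_constantCoeff_zero' (constantCoeff_zSub (half β))
  have e : ∀ i m, lau (Q.subst (zSub (half β))) *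
      (lau (eSeries (half β)) ^ i * modeSeries (half β) m) =
        lau ((geom (-β) ^ i * Q).subst (zSub (half β))) * modeSeries (half β) m := by
    intro i m
    rw [subst_mul hs, subst_pow hs, subst_geom_neg, lau, lau, lau, map_mul, map_pow]
    ring
  rw [e, e, twoPoint_eq_sum_range _ _ 1]
  · rw [Finset.sum_range_one, Nat.cast_zero, neg_zero]
    have h0 := coeff_zero_subst_mul_modeSeries (half β) (geom (-β) ^ j * Q) 0
    rw [Nat.cast_zero] at h0
    rw [coeff_zero_subst_mul_modeSeries, h0, coeff_mul,
      Finset.Nat.sum_antidiagonal_eq_sum_range_succ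
        (fun a b => coeff a (geom (-β) ^ i) * coeff b Q)]
    simp [modeNorm, hQ, constantCoeff_geom]
  · intro m hm
    refine ((vanishesBelow_ofPowerSeries _).mul (vanishesBelow_modeSeries _ _)) _ ?_
    push_cast
    omega

/-- Written in t, the series z̄ = -z/(1 + βz) is -t/(1 + ct). This matches the z̄ in the definition
of the q_n with the one in H^{[β]}. -/
theorem zbarSub_subst_zSub (β : R) : (zbarSub β).subst (zSub (half β)) = zbarSub (half β) := by
  have hs := HasSubst.of_constantCoeff_zero' (constantCoeff_zSub (half β))
  rw [zbarSub, ← coe_substAlgHom hs, map_neg, map_mul, coe_substAlgHom hs, subst_geom_neg,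
    subst_X hs, eSeries, zSub, zbarSub]
  linear_combination (-X * geom (-half β)) * geom_mul_one_sub (half β)

/-- The generating series of the functions `q`, in terms of power sums. -/
def qSeries (β : R) (p : ℕ → R) : PowerSeries R :=
  expSeries (powerSumSeries p - (powerSumSeries p).subst (zbarSub β))

theorem constantCoeff_qExponent (β : R) (p : ℕ → R) :
    constantCoeff (powerSumSeries p - (powerSumSeries p).subst (zbarSub β)) = 0 := by
  rw [map_sub, constantCoeff_subst_zero (constantCoeff_zbarSub β) (constantCoeff_powerSumSeries p),
    constantCoeff_powerSumSeries, sub_self]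

theorem constantCoeff_qSeries (β : R) (p : ℕ → R) : constantCoeff (qSeries β p) = 1 :=
  constantCoeff_expSeries (constantCoeff_qExponent β p)

theorem expSeries_hamSeries (β : R) (p : ℕ → R) :
    expSeries (hamSeries (half β) p) = (qSeries β p).subst (zSub (half β)) := by
  have hs := HasSubst.of_constantCoeff_zero' (constantCoeff_zSub (half β))
  rw [qSeries, ← expSeries_subst (constantCoeff_zSub _) (constantCoeff_qExponent β p),
    subst_sub hs, subst_comp_subst_apply
      (HasSubst.of_constantCoeff_zero' (constantCoeff_zbarSub β)) hs, zbarSub_subst_zSub]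
  rfl

end QExpansion

/-! ### The generating series of the functions `q^{[β]}_n` -/

section QFunctions

open PowerSeries

theorem map_powerSumSeries {s : Finset ℕ} :
    PowerSeries.map (MvPowerSeries.killCompl (R := K) (Function.Embedding.subtype (· ∈ s)) :
      Ser →+* MvPowerSeries s K) (powerSumSeries powerSum) =
      ∑ i : s, (logSeries (MvPowerSeries s K)).subst (C (MvPowerSeries.X i) * X) := by
  classical
  ext1 n
  rw [coeff_map, powerSumSeries, coeff_mk, map_sum]
  have h : ∀ a : MvPowerSeries s K, (logSeries (MvPowerSeries s K)).subst (C a * X) =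
      rescale a (logSeries (MvPowerSeries s K)) := by
    intro a
    rw [rescale_eq_subst, smul_eq_C_mul]
  simp only [h, coeff_rescale]
  simp only [logSeries, coeff_mk]
  rw [← Finset.sum_mul, mul_comm, map_mul, RingHom.map_rat_algebraMap]
  -- The case n = 0 is separate: `powerSum 0` is 1 rather than the number of variables, but the
  -- factor 1/0 = 0 kills both sides.
  rcases eq_or_ne n 0 with rfl | hn
  · simp
  congr 1
  ext d
  rw [map_sum]
  change MvPowerSeries.coeff d (MvPowerSeries.killCompl _ (powerSum n)) = _
  rw [MvPowerSeries.coeff_killCompl]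
  simp only [MvPowerSeries.coeff_X_pow]
  change (if ∃ i : ℕ, Finsupp.embDomain _ d = Finsupp.single i n then (1 : K) else 0) = _
  have key : ∀ i : s, d = Finsupp.single i n ↔
      Finsupp.embDomain (Function.Embedding.subtype (· ∈ s)) d = Finsupp.single (i : ℕ) n := by
    intro i
    rw [← (Finsupp.embDomain_injective (Function.Embedding.subtype (· ∈ s))).eq_iff,
      Finsupp.embDomain_single]
    rfl
  by_cases hd : ∃ i : s, d = Finsupp.single i n
  · obtain ⟨i, hi⟩ := hd
    rw [if_pos ⟨i, (key i).1 hi⟩, Finset.sum_eq_single_of_mem i (Finset.mem_univ i), if_pos hi]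
    intro j _ hj
    rw [if_neg]
    rw [hi]
    exact fun h => hj ((Finsupp.single_left_inj hn).1 h).symm
  · rw [if_neg, Finset.sum_eq_zero]
    · intro i _
      exact if_neg fun h => hd ⟨i, h⟩
    · rintro ⟨i, hi⟩
      have hmem : i ∈ (Finsupp.embDomain (Function.Embedding.subtype (· ∈ s)) d).support := by
        rw [hi]; simp [hn]
      rw [Finsupp.support_embDomain, Finset.mem_map] at hmem
      obtain ⟨j, -, hj⟩ := hmem
      exact hd ⟨j, (key j).2 (by rw [hi, ← hj]; rfl)⟩

/-- With finitely many variables left, Σ p_n X^n/n is a finite sum of logarithms, which the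
exponential turns into the product of the factors. -/
theorem map_qSeries {s : Finset ℕ} :
    PowerSeries.map (MvPowerSeries.killCompl (R := K) (Function.Embedding.subtype (· ∈ s)) :
      Ser →+* MvPowerSeries s K) (qSeries betaS powerSum) =
    PowerSeries.map (MvPowerSeries.killCompl (R := K) (Function.Embedding.subtype (· ∈ s)) :
      Ser →+* MvPowerSeries s K) (∏ i ∈ s, qFactor i) := by
  set φ : Ser →+* MvPowerSeries s K :=
    (MvPowerSeries.killCompl (R := K) (Function.Embedding.subtype (· ∈ s)) :
      Ser →+* MvPowerSeries s K) with hφ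
  have hX : ∀ i : s, φ (MvPowerSeries.X (i : ℕ)) = MvPowerSeries.X i := fun i =>
    MvPowerSeries.killCompl_X (R := K) (e := Function.Embedding.subtype (· ∈ s)) i
  have hz : PowerSeries.map φ (zbarSub betaS) = zbarSub (φ betaS) := by
    rw [zbarSub, zbarSub, map_neg, map_mul, map_geom, map_neg, PowerSeries.map_X]
  have hz' : constantCoeff (zbarSub (φ betaS)) = 0 := constantCoeff_zbarSub _
  have hs := HasSubst.of_constantCoeff_zero' hz'
  have hC : ∀ a : MvPowerSeries s K, constantCoeff (C a * X) = 0 := fun a => by simp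
  have hl := fun a => constantCoeff_subst_zero (hC a)
    (constantCoeff_logSeries (R := MvPowerSeries s K))
  rw [qSeries, map_expSeries φ (constantCoeff_qExponent _ _), map_sub]
  have hsub : PowerSeries.map φ ((powerSumSeries powerSum).subst (zbarSub betaS)) =
      (PowerSeries.map φ (powerSumSeries powerSum)).subst (zbarSub (φ betaS)) := by
    rw [← hz]
    exact map_subst (h := φ)
      (HasSubst.of_constantCoeff_zero' (constantCoeff_zbarSub betaS)) (powerSumSeries powerSum)
  rw [hsub, map_powerSumSeries, ← coe_substAlgHom hs, map_sum, ← Finset.sum_sub_distrib,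
    expSeries_sum, map_prod, ← Finset.prod_coe_sort s]
  · refine Finset.prod_congr rfl fun i _ => ?_
    have e : PowerSeries.substAlgHom hs ((logSeries (MvPowerSeries s K)).subst
        (C (MvPowerSeries.X i : MvPowerSeries s K) * X)) =
        (logSeries (MvPowerSeries s K)).subst
          (C (MvPowerSeries.X i : MvPowerSeries s K) * zbarSub (φ betaS)) := by
      rw [coe_substAlgHom hs, subst_comp_subst_apply (HasSubst.of_constantCoeff_zero' (hC _)) hs,
        subst_mul hs, subst_X hs, subst_C]
      rfl
    have h0 : constantCoeff ((C (MvPowerSeries.X i) : PowerSeries (MvPowerSeries s K)) *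
        zbarSub (φ betaS)) = 0 := by rw [map_mul, hz', mul_zero]
    rw [e, sub_eq_add_neg, expSeries_add (hl _)
      (by rw [map_neg, constantCoeff_subst_zero h0 constantCoeff_logSeries, neg_zero]),
      expSeries_neg_log h0, qFactor, map_mul, map_geom, hX, map_sub, map_one, map_mul,
      PowerSeries.map_C, hX, show (zbar : PowerSeries Ser) = zbarSub betaS from rfl, hz]
    have h1 := expSeries_log_mul (hC (MvPowerSeries.X i))
    have h2 := geom_mul_one_sub (MvPowerSeries.X i : MvPowerSeries s K)
    linear_combination (1 - C (MvPowerSeries.X i) * zbarSub (φ betaS)) *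
      (geom (MvPowerSeries.X i) * h1 -
        expSeries ((logSeries (MvPowerSeries s K)).subst (C (MvPowerSeries.X i) * X)) * h2)
  · intro i _
    rw [map_sub, hl, coe_substAlgHom hs]
    simp [constantCoeff_subst_zero hz' (hl _)]

/-- The coefficient of x^d is unchanged when the variables outside the support of d are set to zero.
-/
theorem coeff_qSeries (n : ℕ) : coeff n (qSeries betaS powerSum) = qNat n := by
  ext d
  set e := Function.Embedding.subtype (· ∈ d.support)
  obtain ⟨d', hd'⟩ : ∃ d', Finsupp.embDomain e d' = d := by
    refine ⟨d.comapDomain e e.injective.injOn, ?_⟩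
    refine Finsupp.embDomain_comapDomain ?_
    intro i hi
    exact ⟨⟨i, hi⟩, rfl⟩
  have h := congrArg (fun f => MvPowerSeries.coeff d' (coeff n f)) (map_qSeries (s := d.support))
  simp only [coeff_map] at h
  change MvPowerSeries.coeff d' (MvPowerSeries.killCompl e _) =
    MvPowerSeries.coeff d' (MvPowerSeries.killCompl e _) at h
  rw [MvPowerSeries.coeff_killCompl, MvPowerSeries.coeff_killCompl, hd'] at h
  rw [h, coeff_prod_qFactor n d d.support (Finset.Subset.refl _)]

end QFunctions

/-! ### The entries of the Pfaffian -/

section Entries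

open PowerSeries

theorem qBeta_natCast (n : ℕ) : qBeta n = qNat n := by simp [qBeta]

theorem qBeta_of_neg {n : ℤ} (hn : n < 0) : qBeta n = 0 := if_neg (by omega)

theorem zeta_last {lam : List ℕ} {i : ℕ} :
    zeta lam i (lam.length + 1) = ∑ k ∈ Finset.range (lam.getD (i - 1) 0 + 1),
      coeff k (geom (-betaS) ^ i) * qNat (lam.getD (i - 1) 0 - k) := by
  rw [zeta, if_pos rfl, part, finsum_eq_sum_of_support_subset
    (s := Finset.range (lam.getD (i - 1) 0 + 1))]
  · refine Finset.sum_congr rfl fun k hk => ?_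
    have hk' := Finset.mem_range.1 hk
    rw [C_gLast, ← Nat.cast_sub (by omega), qBeta_natCast]
  · intro k hk
    by_contra h
    rw [Finset.mem_coe, Finset.mem_range] at h
    exact hk (by dsimp only; rw [qBeta_of_neg (by omega), mul_zero])

/-- Put p = λ_i - k and q = λ_j - l. Then k, l ≥ 0 since q_n = 0 for n < 0, while the support
condition gives l ≤ λ_j and k + l ≤ λ_i + λ_j < N. -/
theorem zeta_of_ne {lam : List ℕ} {i j N : ℕ} (hj : j ≠ lam.length + 1)
    (hN : lam.getD (i - 1) 0 + lam.getD (j - 1) 0 < N) :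
    zeta lam i j = ∑ k ∈ Finset.range N, ∑ l ∈ Finset.range N,
      pairCoeff betaS i j (lam.getD (i - 1) 0 - k) (lam.getD (j - 1) 0 - l) *
        (qNat k * qNat l) := by
  rw [zeta, if_neg hj, part, part]
  set a := lam.getD (i - 1) 0
  set b := lam.getD (j - 1) 0
  set T : ℤ × ℤ → Ser := fun pq => MvPowerSeries.C (gCoeff i j pq.1 pq.2) *
    (qBeta ((a : ℤ) - pq.1) * qBeta ((b : ℤ) - pq.2)) with hT
  have hz : ∀ p q : ℤ, p + q < 0 ∨ q < 0 → T (p, q) = 0 := by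
    intro p q h
    simp only [hT]
    rw [C_gCoeff, pairCoeff_eq_zero _ _ _ h, zero_mul]
  change ∑ᶠ pq : {pq : ℤ × ℤ // 0 ≤ pq.1 + pq.2 ∧ 0 ≤ pq.2}, T pq.1 = _
  rw [← finsum_comp_of_support_subset_range Subtype.val_injective T,
    finsum_comp_of_support_subset_range
      (g := fun kl : ℕ × ℕ => ((a : ℤ) - kl.1, (b : ℤ) - kl.2)),
    finsum_eq_sum_of_support_subset (s := Finset.range N ×ˢ Finset.range N),
    Finset.sum_product]
  · simp [hT, C_gCoeff, qBeta_natCast]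
  · rintro ⟨k, l⟩ hkl
    by_contra h
    refine hkl (hz _ _ ?_)
    simp only [Finset.coe_product, Set.mem_prod, Finset.mem_coe, Finset.mem_range] at h
    omega
  · rintro ⟨k, l⟩ ⟨k', l'⟩ h
    simp only [Prod.mk.injEq] at h ⊢
    omega
  · rintro ⟨p, q⟩ h
    have hp : 0 ≤ (a : ℤ) - p := by
      by_contra hneg
      exact h (by simp only [hT]; rw [qBeta_of_neg (n := a - p) (by omega), zero_mul, mul_zero])
    have hq : 0 ≤ (b : ℤ) - q := by
      by_contra hneg
      exact h (by simp only [hT]; rw [qBeta_of_neg (n := b - q) (by omega), mul_zero, mul_zero])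
    exact ⟨((a - p).toNat, (b - q).toNat), Prod.ext (by simp only; omega) (by simp only; omega)⟩
  · rintro ⟨p, q⟩ h
    by_contra hneg
    refine h (hz p q ?_)
    simp only [Subtype.range_coe_subtype, Set.mem_ofPred_eq] at hneg
    omega

theorem twoPoint_entrySeries (lam : List ℕ) {i j : ℕ} :
    twoPoint (entrySeries betaS powerSum lam i) (entrySeries betaS powerSum lam j) =
      zeta lam (i + 1) (j + 1) := by
  rw [entrySeries, entrySeries, expSeries_hamSeries]
  by_cases hj : j = lam.length
  -- Counted from 0, the column `lam.length` belongs to the padded part, whose value is the default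
  -- 0.
  · subst hj
    rw [zeta_last, List.getD_eq_default (hn := le_rfl), Nat.add_sub_cancel,
      twoPoint_subst_zero _ (constantCoeff_qSeries _ _)]
    simp only [coeff_qSeries]
  · rw [zeta_of_ne (by omega) (Nat.lt_succ_self _), twoPoint_subst (N := _ + _ + 1)]
    · simp only [coeff_qSeries]
      rfl
    · simp only [Nat.add_sub_cancel]
      push_cast
      omega
    · simp only [Nat.add_sub_cancel]
      push_cast
      omega

theorem oFun_eq_pfaffian (lam : List ℕ) :
    oFun lam = algebraMap ℚ Ser ((1 / 2) ^ lam.length) *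
      pfaffian ((lam.length + 1) / 2) fun i j => zeta lam (i.val + 1) (j.val + 1) := by
  rw [oFun, dualO_eq_pfaffian]
  congr 1
  exact pfaffian_congr fun i j _ => twoPoint_entrySeries lam

theorem pfaffian_of_eq_one {R : Type*} [CommRing R] {m : ℕ} (hm : m = 1) (a : ℕ → ℕ → R) :
    pfaffian m (fun i j => a i j) = a 0 1 := by
  subst hm
  rw [pfaffian_succ 0]
  simp [pfaffian_zero]

theorem oFun_singleton (n : ℕ) :
    oFun [n] = algebraMap ℚ Ser (1 / 2) *
      ∑ k ∈ Finset.range (n + 1), (-betaS) ^ k * qBeta ((n : ℤ) - (k : ℤ)) := by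
  -- For r = 1 the second column is the column r + 1, so the single entry is of the last kind.
  have h' : zeta [n] (0 + 1) (1 + 1) = zeta [n] 1 ([n].length + 1) := rfl
  rw [oFun_eq_pfaffian, List.length_singleton, pow_one,
    pfaffian_of_eq_one (by norm_num) fun i j => zeta [n] (i + 1) (j + 1), h', zeta_last]
  congr 1
  refine Finset.sum_congr rfl fun k hk => ?_
  have hk' := Finset.mem_range.1 hk
  change k < n + 1 at hk'
  rw [pow_one, geom, coeff_mk, ← Nat.cast_sub (by omega), qBeta_natCast]
  rfl

end Entries

end DualKQ

end

theorem mainTheorem7 :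
    -- the coefficients `g` lie in `ℚ[β]`, and the expansion runs over `p + q ≥ 0`, `q ≥ 0`
    (∀ (i j : ℕ) (p q : ℤ),
      DualKQ.gCoeff i j p q ∈ Set.range (algebraMap (Polynomial ℚ) DualKQ.K) ∧
        (DualKQ.gCoeff i j p q ≠ 0 → 0 ≤ p + q ∧ 0 ≤ q)) ∧
    (∀ i p : ℕ, DualKQ.gLast i p ∈ Set.range (algebraMap (Polynomial ℚ) DualKQ.K)) ∧
    -- the Pfaffian formula for a strict partition of length `r`, with `r' = 2 * ((r + 1) / 2)`
    (∀ lam : List ℕ, lam.Pairwise (· > ·) → (∀ a ∈ lam, 0 < a) →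
      DualKQ.oFun lam =
        algebraMap ℚ DualKQ.Ser ((1 / 2) ^ lam.length) *
          DualKQ.pfaffian ((lam.length + 1) / 2)
            (fun i j => DualKQ.zeta lam (i.val + 1) (j.val + 1))) ∧
    -- the one-row case
    (∀ n : ℕ,
      DualKQ.oFun [n] =
        algebraMap ℚ DualKQ.Ser (1 / 2) *
          ∑ k ∈ Finset.range (n + 1),
            (-DualKQ.betaS) ^ k * DualKQ.qBeta ((n : ℤ) - (k : ℤ))) :=
  ⟨fun i j p q => ⟨DualKQ.gCoeff_mem_range i j p q, fun h => by
      by_contra hpq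
      refine h ?_
      rw [DualKQ.gCoeff_eq_pairCoeff]
      exact DualKQ.pairCoeff_eq_zero _ _ _ (by omega)⟩,
    DualKQ.gLast_mem_range, fun lam _ _ => DualKQ.oFun_eq_pfaffian lam, DualKQ.oFun_singleton⟩
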